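/- Let $K=\mathbb{Q}(\theta)$ be a number field, where $\theta$ is a root of a monic irreducible polynomial $F(x)=x^7+ax^5+b\in\mathbb{Z}[x]$. Let $A_K$ be the ring of integers of $K$, and let $$i(K)=\gcd\{\,(A_K:\mathbb{Z}[\eta]) \;:\; \eta\in A_K,\ K=\mathbb{Q}(\eta)\,\}$$ be the index of $K$, where $(A_K:\mathbb{Z}[\eta])=|A_K/\mathbb{Z}[\eta]|$; a rational prime dividing $i(K)$ is called a common index divisor of $K$. Then no odd rational prime $p$ is a common index divisor of $K$, i.e. $p\nmid i(K)$ for every odd prime $p$. Consequently $i(K)=2^k$ for some integer $k\ge 0$. -/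

import Mathlib

open Polynomial
open scoped NumberField IntermediateField

/-- The index `(A_K : ℤ[η])` of an algebraic integer `η` of `K`: the index of `ℤ[η]` in the
ring of integers of `K`, as additive groups. -/
noncomputable def elementIndex (K : Type*) [Field K] [NumberField K] (η : 𝓞 K) : ℕ :=
  (Algebra.adjoin ℤ {η}).toSubmodule.toAddSubgroup.index

/-- The index `i(K)` of a number field: the greatest natural number dividing the index
`(A_K : ℤ[η])` of every algebraic integer `η` with `K = ℚ(η)`. -/
noncomputable def fieldIndex (K : Type*) [Field K] [NumberField K] : ℕ :=
  sSup {d : ℕ | ∀ η : 𝓞 K, ℚ⟮(η : K)⟯ = ⊤ → d ∣ elementIndex K η}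

/-- A common index divisor of `K`: a rational prime dividing `i(K)`. -/
def IsCommonIndexDivisor (K : Type*) [Field K] [NumberField K] (p : ℕ) : Prop :=
  p.Prime ∧ p ∣ fieldIndex K

/-! For a prime `P` above `p` let e, f be its ramification index and residue degree, and v_P the
order at `P`. If distinct monic irreducible polynomials g_P over F_p with deg g_P = f can be
attached to the primes above `p`, then `p` does not divide i(K). Indeed the Chinese remainder
theorem gives η with g_P(η) in P but not in P² for every P. If h(η) ∈ pA_K, then ∏ g_P^e, of degree
∑ ef = [K:ℚ], divides h mod p. So polynomials of smaller degree inject into A_K/p, hence fill it by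
counting; by Nakayama the index of ℤ[η] is prime to `p`.

In degree 7 with `p` odd there are always enough irreducibles of each degree ≥ 2, so the only
possible obstruction is more than `p` primes with f = 1. For p ≥ 7 this cannot happen. For p = 3, 5
the Newton polygon of F bounds their number. It has one side of length 7, or two sides of lengths 2
and 5. The side of length 2 carries at most two primes. On a side of length 5 or 7 with non-integral
slope, 5 or 7 divides e, leaving at most one prime. On a side of integral slope k, degree-one primes
are sorted by the residue c of θ/p^k: N primes sharing c force p^N to divide F(cp^k) beyond its
generic power of p, for every lift of c, and finite differences in c limit N
(`exists_card_le_sum_residue` and the bounds after it). -/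

/-! ### Orders at primes of a Dedekind domain -/

section Valuation

open UniqueFactorizationMonoid

variable {R : Type*} [CommRing R] [IsDedekindDomain R]

/-- The multiplicity of the ideal `P` in the factorization of the principal ideal `(x)`. -/
noncomputable def idealOrd (P : Ideal R) (x : R) : ℕ :=
  letI := Classical.decEq (Ideal R)
  (normalizedFactors (Ideal.span {x})).count P

theorem le_idealOrd_iff {P : Ideal R} (hP : Prime P) {x : R} (hx : x ≠ 0) (m : ℕ) :
    m ≤ idealOrd P x ↔ x ∈ P ^ m := by
  classical
  have h0 : Ideal.span {x} ≠ 0 := by simpa using hx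
  rw [← Ideal.dvd_span_singleton, pow_dvd_iff_le_emultiplicity,
    emultiplicity_eq_count_normalizedFactors hP.irreducible h0, idealOrd]
  simp only [normalize_eq, Nat.cast_le]
  convert Iff.rfl

theorem idealOrd_mul (P : Ideal R) {x y : R} (hx : x ≠ 0) (hy : y ≠ 0) :
    idealOrd P (x * y) = idealOrd P x + idealOrd P y := by
  classical
  have h0 : Ideal.span {x} ≠ 0 := by simpa using hx
  have h1 : Ideal.span {y} ≠ 0 := by simpa using hy
  rw [idealOrd, ← Ideal.span_singleton_mul_span_singleton, normalizedFactors_mul h0 h1,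
    Multiset.count_add]
  rfl

theorem idealOrd_one (P : Ideal R) : idealOrd P (1 : R) = 0 := by
  have := idealOrd_mul P (one_ne_zero (α := R)) one_ne_zero
  simp only [mul_one] at this
  omega

theorem idealOrd_pow (P : Ideal R) {x : R} (hx : x ≠ 0) (n : ℕ) :
    idealOrd P (x ^ n) = n * idealOrd P x := by
  induction n with
  | zero => simp [idealOrd_one]
  | succ n ih => rw [pow_succ, idealOrd_mul P (pow_ne_zero n hx) hx, ih]; ring

/-- Applied to each of the three terms in turn, this says that the minimal order is attained at
least twice, which is all of the Newton polygon that is needed. -/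
theorem min_le_idealOrd_of_add_add_eq_zero {P : Ideal R} (hP : Prime P) {x y z : R}
    (hx : x ≠ 0) (hy : y ≠ 0) (hz : z ≠ 0) (h : x + y + z = 0) :
    min (idealOrd P y) (idealOrd P z) ≤ idealOrd P x := by
  rw [le_idealOrd_iff hP hx]
  have hxx : x = -(y + z) := by linear_combination h
  rw [hxx]
  refine neg_mem (add_mem ?_ ?_)
  · exact (le_idealOrd_iff hP hy _).1 (min_le_left _ _)
  · exact (le_idealOrd_iff hP hz _).1 (min_le_right _ _)

/-- The primes of `R` above `p`. -/
noncomputable def primesAbove (R : Type*) [CommRing R] [IsDedekindDomain R] (p : ℕ) :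
    Finset (Ideal R) :=
  letI := Classical.decEq (Ideal R)
  (normalizedFactors (Ideal.span {(p : R)})).toFinset

theorem mem_primesAbove_iff [CharZero R] {p : ℕ} (hp : p.Prime) {P : Ideal R} :
    P ∈ primesAbove R p ↔ Prime P ∧ (p : R) ∈ P := by
  have h0 : Ideal.span {(p : R)} ≠ 0 := by simpa using (Nat.cast_ne_zero (R := R)).2 hp.ne_zero
  rw [primesAbove, Multiset.mem_toFinset, UniqueFactorizationMonoid.mem_normalizedFactors_iff h0,
    Ideal.dvd_span_singleton]

theorem one_le_idealOrd_of_mem_primesAbove [CharZero R] {p : ℕ} (hp : p.Prime) {P : Ideal R}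
    (hP : P ∈ primesAbove R p) : 1 ≤ idealOrd P (p : R) := by
  obtain ⟨h1, h2⟩ := (mem_primesAbove_iff hp).1 hP
  rw [le_idealOrd_iff h1 (Nat.cast_ne_zero.2 hp.ne_zero)]
  simpa using h2

end Valuation

/-! ### Absolute norms, residue degrees and ∑ ef = n -/

section Norm

open UniqueFactorizationMonoid Ideal

variable {R : Type*} [CommRing R] [IsDedekindDomain R] [Module.Free ℤ R] [Module.Finite ℤ R]

/-- The exponent of `p` in the absolute norm of the ideal `P`; this is the residue degree when
`P` is a prime above `p`. -/
noncomputable def residueDeg (p : ℕ) (P : Ideal R) : ℕ := (absNorm P).factorization p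

theorem natCast_mem_of_dvd_absNorm {p : ℕ} (hp : p.Prime) {P : Ideal R} (hP : Prime P)
    (h : p ∣ absNorm P) : (p : R) ∈ P := by
  have hfin : Finite (R ⧸ P) := (absNorm_ne_zero_iff P).1 (by
    rw [Ne, absNorm_eq_zero_iff]; exact hP.ne_zero)
  have : Fact p.Prime := ⟨hp⟩
  have := isPrime_of_prime hP
  have h' : p ∣ Nat.card (R ⧸ P) := h
  -- Cauchy: a nonzero element killed by `p` in the domain R/P forces p = 0 there.
  obtain ⟨x, hx⟩ := exists_prime_addOrderOf_dvd_card' p h'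
  have h1 : (p : R ⧸ P) * x = 0 := by
    rw [← nsmul_eq_mul, ← hx]; exact addOrderOf_nsmul_eq_zero x
  have h2 : x ≠ 0 := by
    rintro rfl
    rw [addOrderOf_zero] at hx
    exact hp.one_lt.ne hx
  have h3 : (p : R ⧸ P) = 0 := (mul_eq_zero.1 h1).resolve_right h2
  rw [← Ideal.Quotient.eq_zero_iff_mem]
  simpa using h3

theorem residueDeg_eq_zero_of_notMem [CharZero R] {p : ℕ} (hp : p.Prime) {P : Ideal R}
    (hP : Prime P) (h : P ∉ primesAbove R p) : residueDeg p P = 0 := by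
  refine Nat.factorization_eq_zero_of_not_dvd fun hd => h ?_
  exact (mem_primesAbove_iff hp).2 ⟨hP, natCast_mem_of_dvd_absNorm hp hP hd⟩

theorem factorization_absNorm_span [CharZero R] {p : ℕ} (hp : p.Prime) {x : R} (hx : x ≠ 0) :
    (absNorm (span {x})).factorization p =
      ∑ P ∈ primesAbove R p, residueDeg p P * idealOrd P x := by
  classical
  have h0 : span {x} ≠ 0 := by simpa using hx
  set s := normalizedFactors (span {x}) with hs
  have hprod : s.prod = span {x} := by
    simpa using prod_normalizedFactors_eq h0
  have hprime : ∀ Q ∈ s, Prime Q := fun Q hQ => prime_of_normalized_factor Q hQ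
  have key : ∀ t : Multiset (Ideal R), (∀ Q ∈ t, Prime Q) →
      (absNorm t.prod).factorization p = (t.map (residueDeg p)).sum := by
    intro t
    induction t using Multiset.induction_on with
    | empty => simp
    | cons a t ih =>
      intro ht
      have ha := ht a (Multiset.mem_cons_self a t)
      have ht' : ∀ Q ∈ t, Prime Q := fun Q hQ => ht Q (Multiset.mem_cons_of_mem hQ)
      rw [Multiset.prod_cons, map_mul, Nat.factorization_mul, Finsupp.add_apply, ih ht',
        Multiset.map_cons, Multiset.sum_cons, residueDeg]
      · rw [Ne, absNorm_eq_zero_iff]; exact ha.ne_zero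
      · rw [Ne, absNorm_eq_zero_iff]
        exact Multiset.prod_ne_zero fun h => (ht' 0 h).ne_zero rfl
  rw [← hprod, key s hprime, Finset.sum_multiset_map_count]
  -- Both index sets are enlarged to their union: the multiplicity vanishes off `s`, the residue
  -- degree off the primes above `p`.
  have e1 : ∑ m ∈ s.toFinset, s.count m • residueDeg p m =
      ∑ m ∈ s.toFinset ∪ primesAbove R p, s.count m • residueDeg p m := by
    refine Finset.sum_subset Finset.subset_union_left fun m _ hm => ?_
    rw [Multiset.mem_toFinset] at hm
    simp [Multiset.count_eq_zero_of_notMem hm]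
  have e2 : ∑ m ∈ primesAbove R p, s.count m • residueDeg p m =
      ∑ m ∈ s.toFinset ∪ primesAbove R p, s.count m • residueDeg p m := by
    refine Finset.sum_subset Finset.subset_union_right fun m hm hm' => ?_
    have : m ∈ s := by
      rcases Finset.mem_union.1 hm with h | h
      · exact Multiset.mem_toFinset.1 h
      · exact absurd h hm'
    simp [residueDeg_eq_zero_of_notMem hp (hprime m this) hm']
  rw [e1, ← e2]
  refine Finset.sum_congr rfl fun m _ => ?_
  rw [smul_eq_mul, mul_comm, idealOrd, hs]
  congr 2

theorem sum_residueDeg_mul_idealOrd [CharZero R] {p : ℕ} (hp : p.Prime) :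
    ∑ P ∈ primesAbove R p, residueDeg p P * idealOrd P (p : R) = Module.finrank ℤ R := by
  rw [← factorization_absNorm_span hp (Nat.cast_ne_zero.2 hp.ne_zero), absNorm_span_natCast,
    hp.factorization_pow, Finsupp.single_eq_same]

theorem absNorm_eq_pow_residueDeg [CharZero R] {p : ℕ} (hp : p.Prime) {P : Ideal R}
    (hP : P ∈ primesAbove R p) : absNorm P = p ^ residueDeg p P := by
  have h1 : absNorm P ∣ p ^ Module.finrank ℤ R := by
    rw [← absNorm_span_natCast]
    refine absNorm_dvd_absNorm_of_le ?_
    rw [span_singleton_le_iff_mem]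
    exact ((mem_primesAbove_iff hp).1 hP).2
  obtain ⟨k, -, hk⟩ := (Nat.dvd_prime_pow hp).1 h1
  rw [residueDeg, hk, hp.factorization_pow, Finsupp.single_eq_same]

theorem one_le_residueDeg [CharZero R] {p : ℕ} (hp : p.Prime) {P : Ideal R}
    (hP : P ∈ primesAbove R p) : 1 ≤ residueDeg p P := by
  by_contra! h
  have h1 := absNorm_eq_pow_residueDeg hp hP
  have h2 : residueDeg p P = 0 := by omega
  rw [h2, pow_zero, absNorm_eq_one_iff] at h1
  have := isPrime_of_prime ((mem_primesAbove_iff hp).1 hP).1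
  exact this.ne_top h1

end Norm

/-! ### Divisibility mod p read off from values at an element -/

section Reduction

theorem Polynomial.exists_C_mul_of_map_zmod_eq_zero {p : ℕ} {h : ℤ[X]}
    (hh : h.map (Int.castRingHom (ZMod p)) = 0) : ∃ r : ℤ[X], h = C (p : ℤ) * r := by
  refine (C_dvd_iff_dvd_coeff _ _).2 fun i => ?_
  have := congrArg (fun q => coeff q i) hh
  simpa [ZMod.intCast_zmod_eq_zero_iff_dvd] using this

theorem Polynomial.exists_eq_add_of_map_zmod_eq {p : ℕ} {h k : ℤ[X]}
    (hh : h.map (Int.castRingHom (ZMod p)) = k.map (Int.castRingHom (ZMod p))) :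
    ∃ r : ℤ[X], h = k + C (p : ℤ) * r := by
  obtain ⟨r, hr⟩ := exists_C_mul_of_map_zmod_eq_zero (p := p) (h := h - k) (by simp [hh])
  exact ⟨r, by linear_combination hr⟩

theorem Polynomial.map_zmod_surjective (p : ℕ) :
    Function.Surjective (Polynomial.map (Int.castRingHom (ZMod p))) :=
  Polynomial.map_surjective _ (ZMod.ringHom_surjective _)

variable {R : Type*} [CommRing R]

/-- Otherwise a Bézout relation ug + vh = 1 mod p, evaluated at `x`, puts 1 in `P`. -/
theorem map_zmod_dvd_of_aeval_mem {p : ℕ} [Fact p.Prime] {P : Ideal R} (hP : P ≠ ⊤)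
    (hp : (p : R) ∈ P) {g h : ℤ[X]} (hg : Irreducible (g.map (Int.castRingHom (ZMod p))))
    {x : R} (hgx : aeval x g ∈ P) (hhx : aeval x h ∈ P) :
    g.map (Int.castRingHom (ZMod p)) ∣ h.map (Int.castRingHom (ZMod p)) := by
  by_contra hnd
  obtain ⟨u, v, huv⟩ := (hg.coprime_iff_not_dvd).2 hnd
  obtain ⟨u, rfl⟩ := map_zmod_surjective p u
  obtain ⟨v, rfl⟩ := map_zmod_surjective p v
  obtain ⟨r, hr⟩ := exists_eq_add_of_map_zmod_eq (p := p) (h := u * g + v * h) (k := 1)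
    (by simpa using huv)
  have h1 := congrArg (aeval x) hr
  simp only [map_add, map_mul, map_one, map_natCast] at h1
  refine hP ((Ideal.eq_top_iff_one P).2 ?_)
  have h2 : (1 : R) = aeval x u * aeval x g + aeval x v * aeval x h - p * aeval x r := by
    rw [h1]; ring
  rw [h2]
  exact sub_mem (add_mem (P.mul_mem_left _ hgx) (P.mul_mem_left _ hhx)) (P.mul_mem_right _ hp)

theorem aeval_sub_aeval_mem {I : Ideal R} {x y : R} (h : x - y ∈ I) (g : ℤ[X]) :
    aeval x g - aeval y g ∈ I := by
  have := sub_dvd_eval_sub x y (g.map (algebraMap ℤ R))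
  rw [eval_map_algebraMap, eval_map_algebraMap] at this
  exact I.mem_of_dvd this h

variable [IsDedekindDomain R]

/-- Write h = g^m k + pr. Since g(x) has order exactly 1 and p lies in P^(m+1), k(x) is in P, so g
divides k mod p. It is used with m = e. -/
theorem pow_map_zmod_dvd_of_aeval_mem_pow {p : ℕ} [Fact p.Prime] {P : Ideal R} (hP : Prime P)
    {g : ℤ[X]} (hg : Irreducible (g.map (Int.castRingHom (ZMod p))))
    {x : R} (hgx : aeval x g ∈ P) (hgx2 : aeval x g ∉ P ^ 2) (m : ℕ) (hp : (p : R) ∈ P ^ m) :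
    ∀ {h : ℤ[X]}, aeval x h ∈ P ^ m →
      g.map (Int.castRingHom (ZMod p)) ^ m ∣ h.map (Int.castRingHom (ZMod p)) := by
  have hPt : P ≠ ⊤ := (Ideal.isPrime_of_prime hP).ne_top
  induction m with
  | zero => simp
  | succ m ih =>
    intro h hh
    obtain ⟨k, hk⟩ := ih (Ideal.pow_le_pow_right m.le_succ hp)
      (Ideal.pow_le_pow_right m.le_succ hh)
    obtain ⟨k, rfl⟩ := map_zmod_surjective p k
    rw [← Polynomial.map_pow, ← Polynomial.map_mul] at hk
    obtain ⟨r, hr⟩ := exists_eq_add_of_map_zmod_eq hk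
    have h1 := congrArg (aeval x) hr
    simp only [map_add, map_mul, map_pow, map_natCast] at h1
    have h2 : aeval x g ^ m * aeval x k ∈ P ^ (m + 1) := by
      have : aeval x g ^ m * aeval x k = aeval x h - p * aeval x r := by rw [h1]; ring
      rw [this]
      exact sub_mem hh (Ideal.mul_mem_right _ _ hp)
    have h3 : aeval x k ∈ P := by
      rcases eq_or_ne (aeval x k) 0 with h0 | h0
      · rw [h0]; exact zero_mem P
      have hg0 : aeval x g ≠ 0 := fun h => hgx2 (h ▸ zero_mem _)
      rw [← le_idealOrd_iff hP (mul_ne_zero (pow_ne_zero m hg0) h0),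
        idealOrd_mul P (pow_ne_zero m hg0) h0, idealOrd_pow P hg0] at h2
      rw [← le_idealOrd_iff hP hg0] at hgx2
      have h4 : idealOrd P (aeval x g) ≤ 1 := by omega
      have h5 : m * idealOrd P (aeval x g) ≤ m * 1 := Nat.mul_le_mul_left m h4
      have h6 := (le_idealOrd_iff hP h0 1).1 (by omega)
      simpa using h6
    have hpP : (p : R) ∈ P := Ideal.pow_le_self m.succ_ne_zero hp
    obtain ⟨l, hl⟩ := map_zmod_dvd_of_aeval_mem hPt hpP hg hgx h3
    refine ⟨l, ?_⟩
    rw [hk, Polynomial.map_mul, Polynomial.map_pow, hl]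
    ring

/-- As in Hensel's lemma: F_p is perfect, so g'(x) is a unit at P; if g(x) ∈ P², moving x by π of
order 1 gives g(x + π) ≡ g'(x)π mod P². -/
theorem exists_aeval_mem_notMem_sq {p : ℕ} [Fact p.Prime] {P : Ideal R} (hP : Prime P)
    (hp : (p : R) ∈ P) {g : ℤ[X]} (hg : Irreducible (g.map (Int.castRingHom (ZMod p))))
    {x : R} (hgx : aeval x g ∈ P) : ∃ y : R, aeval y g ∈ P ∧ aeval y g ∉ P ^ 2 := by
  by_cases h2 : aeval x g ∈ P ^ 2
  swap
  · exact ⟨x, hgx, h2⟩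
  have hpr := Ideal.isPrime_of_prime hP
  obtain ⟨π, hπ, hπ2⟩ : ∃ π ∈ P, π ∉ P ^ 2 := by
    have := Ideal.pow_succ_lt_pow hP.ne_zero 1
    simpa using SetLike.exists_of_lt this
  have hd : aeval x (derivative g) ∉ P := by
    intro hd
    have h3 := map_zmod_dvd_of_aeval_mem hpr.ne_top hp hg hgx hd
    have hsep : (g.map (Int.castRingHom (ZMod p))).Separable :=
      PerfectField.separable_of_irreducible hg
    rw [separable_def, derivative_map] at hsep
    exact hg.not_isUnit (hsep.isUnit_of_dvd' dvd_rfl h3)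
  obtain ⟨k, hk⟩ := (g.map (algebraMap ℤ R)).binomExpansion x π
  rw [eval_map_algebraMap, eval_map_algebraMap, derivative_map, eval_map_algebraMap] at hk
  have hk2 : k * π ^ 2 ∈ P ^ 2 := Ideal.mul_mem_left _ _ (Ideal.pow_mem_pow hπ 2)
  refine ⟨x + π, ?_, fun hc => ?_⟩
  · rw [hk]
    exact add_mem (add_mem hgx (P.mul_mem_left _ hπ))
      (P.mul_mem_left _ (P.pow_mem_of_mem hπ 2 two_pos))
  · have h4 : aeval x (derivative g) * π ∈ P ^ 2 := by
      have : aeval x (derivative g) * π = aeval (x + π) g - aeval x g - k * π ^ 2 := by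
        rw [hk]; ring
      rw [this]
      exact sub_mem (sub_mem hc h2) hk2
    have hd0 : aeval x (derivative g) ≠ 0 := fun h => hd (h ▸ zero_mem _)
    have hπ0 : π ≠ 0 := fun h => hπ2 (h ▸ zero_mem _)
    rw [← le_idealOrd_iff hP (mul_ne_zero hd0 hπ0), idealOrd_mul P hd0 hπ0] at h4
    rw [← le_idealOrd_iff hP hπ0] at hπ2
    refine hd ?_
    have := (le_idealOrd_iff hP hd0 1).1 (by omega)
    simpa using this

end Reduction

theorem FiniteField.exists_aeval_eq_zero_of_irreducible {p : ℕ} [Fact p.Prime] (F : Type*)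
    [Field F] [Finite F] [Algebra (ZMod p) F] {g : (ZMod p)[X]} (hg : Irreducible g)
    (hF : Nat.card F = p ^ g.natDegree) : ∃ x : F, aeval x g = 0 := by
  have := Fintype.ofFinite F
  have h1 : g ∣ X ^ Nat.card F - X := by
    have := (hg.natDegree_dvd_iff_dvd_X_pow_card_pow_sub_X (n := g.natDegree)).1 dvd_rfl
    rwa [Nat.card_zmod, ← hF] at this
  have h2 := FiniteField.isSplittingField_sub F (ZMod p)
  rw [Fintype.card_eq_nat_card] at h2
  have h3 := h2.splits
  have hne : (X ^ Nat.card F - X : (ZMod p)[X]) ≠ 0 :=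
    FiniteField.X_pow_card_sub_X_ne_zero _ Finite.one_lt_card
  have h4 := h3.of_dvd (Polynomial.map_ne_zero hne) (Polynomial.map_dvd (algebraMap (ZMod p) F) h1)
  obtain ⟨x, hx⟩ := h4.exists_eval_eq_zero (by
    rw [degree_map]; exact (degree_pos_of_irreducible hg).ne')
  exact ⟨x, by rwa [eval_map_algebraMap] at hx⟩

/-! ### Generating A_K modulo p by one element -/

section Criterion

open Ideal

variable {R : Type*} [CommRing R] [IsDedekindDomain R] [Module.Free ℤ R] [Module.Finite ℤ R]
  [CharZero R]

theorem exists_aeval_mem_of_natDegree_eq_residueDeg {p : ℕ} [hp : Fact p.Prime] {P : Ideal R}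
    (hP : P ∈ primesAbove R p) {g : ℤ[X]}
    (hg : Irreducible (g.map (Int.castRingHom (ZMod p))))
    (hdeg : (g.map (Int.castRingHom (ZMod p))).natDegree = residueDeg p P) :
    ∃ x : R, aeval x g ∈ P := by
  obtain ⟨hPr, hpP⟩ := (mem_primesAbove_iff hp.out).1 hP
  have hpr := isPrime_of_prime hPr
  have hmax : P.IsMaximal := hpr.isMaximal hPr.ne_zero
  let := Ideal.Quotient.field P
  have hcard : Nat.card (R ⧸ P) = p ^ residueDeg p P := absNorm_eq_pow_residueDeg hp.out hP
  have : Finite (R ⧸ P) := Nat.finite_of_card_ne_zero (by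
    rw [hcard]; exact pow_ne_zero _ hp.out.ne_zero)
  have hp0 : (p : R ⧸ P) = 0 := by
    have := Ideal.Quotient.eq_zero_iff_mem.2 hpP
    simpa using this
  have : CharP (R ⧸ P) p := (CharP.charP_iff_prime_eq_zero hp.out).2 hp0
  let : Algebra (ZMod p) (R ⧸ P) := ZMod.algebra _ p
  obtain ⟨y, hy⟩ := FiniteField.exists_aeval_eq_zero_of_irreducible (R ⧸ P) hg
    (by rw [hcard, hdeg])
  obtain ⟨x, rfl⟩ := Ideal.Quotient.mk_surjective y
  refine ⟨x, ?_⟩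
  rw [← Ideal.Quotient.eq_zero_iff_mem, ← hy, aeval_def, aeval_def, hom_eval₂, eval₂_map]
  congr 1
  exact RingHom.ext_int _ _

theorem exists_forall_aeval_mem_notMem_sq {p : ℕ} [hp : Fact p.Prime] (g : Ideal R → ℤ[X])
    (hg : ∀ P ∈ primesAbove R p, Irreducible ((g P).map (Int.castRingHom (ZMod p))))
    (hdeg : ∀ P ∈ primesAbove R p,
      ((g P).map (Int.castRingHom (ZMod p))).natDegree = residueDeg p P) :
    ∃ x : R, ∀ P ∈ primesAbove R p, aeval x (g P) ∈ P ∧ aeval x (g P) ∉ P ^ 2 := by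
  have h1 : ∀ P : primesAbove R p,
      ∃ y : R, aeval y (g P) ∈ (P : Ideal R) ∧ aeval y (g P) ∉ (P : Ideal R) ^ 2 := by
    rintro ⟨P, hP⟩
    obtain ⟨hPr, hpP⟩ := (mem_primesAbove_iff hp.out).1 hP
    obtain ⟨x, hx⟩ := exists_aeval_mem_of_natDegree_eq_residueDeg hP (hg P hP) (hdeg P hP)
    exact exists_aeval_mem_notMem_sq hPr hpP (hg P hP) hx
  choose y hy1 hy2 using h1
  obtain ⟨x, hx⟩ := IsDedekindDomain.exists_forall_sub_mem_ideal (s := primesAbove R p)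
    (fun P => P) (fun _ => 2) (fun P hP => ((mem_primesAbove_iff hp.out).1 hP).1)
    (fun _ _ _ _ h => h) y
  refine ⟨x, fun P hP => ?_⟩
  have h2 := aeval_sub_aeval_mem (hx P hP) (g P)
  refine ⟨?_, fun hc => hy2 ⟨P, hP⟩ ?_⟩
  · have h3 : aeval x (g P) - aeval (y ⟨P, hP⟩) (g P) ∈ P := Ideal.pow_le_self two_ne_zero h2
    simpa using add_mem h3 (hy1 ⟨P, hP⟩)
  · simpa using sub_mem hc h2

theorem map_zmod_eq_zero_of_aeval_mem_span {p : ℕ} [hp : Fact p.Prime] {g : Ideal R → ℤ[X]}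
    (hg : ∀ P ∈ primesAbove R p, Irreducible ((g P).map (Int.castRingHom (ZMod p))))
    (hmonic : ∀ P ∈ primesAbove R p, ((g P).map (Int.castRingHom (ZMod p))).Monic)
    (hdeg : ∀ P ∈ primesAbove R p,
      ((g P).map (Int.castRingHom (ZMod p))).natDegree = residueDeg p P)
    (hinj : Set.InjOn (fun P => (g P).map (Int.castRingHom (ZMod p))) (primesAbove R p))
    {x : R} (hx : ∀ P ∈ primesAbove R p, aeval x (g P) ∈ P ∧ aeval x (g P) ∉ P ^ 2)
    {h : ℤ[X]} (hh : aeval x h ∈ span {(p : R)})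
    (hlt : (h.map (Int.castRingHom (ZMod p))).degree < Module.finrank ℤ R) :
    h.map (Int.castRingHom (ZMod p)) = 0 := by
  by_contra h0
  have hdvd : ∏ P ∈ primesAbove R p, (g P).map (Int.castRingHom (ZMod p)) ^ idealOrd P (p : R) ∣
      h.map (Int.castRingHom (ZMod p)) := by
    refine Finset.prod_dvd_of_coprime (fun P hP Q hQ hPQ => ?_) fun P hP => ?_
    · refine IsCoprime.pow ((hg P hP).coprime_iff_not_dvd.2 fun hd => hPQ (hinj hP hQ ?_))
      exact eq_of_monic_of_associated (hmonic P hP) (hmonic Q hQ)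
        ((hg P hP).associated_of_dvd (hg Q hQ) hd)
    · obtain ⟨hPr, hpP⟩ := (mem_primesAbove_iff hp.out).1 hP
      have hpm : (p : R) ∈ P ^ idealOrd P (p : R) :=
        (le_idealOrd_iff hPr (Nat.cast_ne_zero.2 hp.out.ne_zero) _).1 le_rfl
      exact pow_map_zmod_dvd_of_aeval_mem_pow hPr (hg P hP) (hx P hP).1 (hx P hP).2 _ hpm
        ((span_singleton_le_iff_mem _).2 hpm hh)
  have h1 := natDegree_le_of_dvd hdvd h0
  rw [natDegree_prod_of_monic _ _ fun P hP => (hmonic P hP).pow _] at h1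
  rw [Finset.sum_congr rfl fun P hP => by
    rw [(hmonic P hP).natDegree_pow, hdeg P hP, mul_comm], sum_residueDeg_mul_idealOrd hp.out] at h1
  exact absurd (natDegree_lt_iff_degree_lt h0 |>.2 hlt) (by omega)

/-- Evaluation at `x` maps polynomials of degree < n over F_p injectively to R/p; both sets have p^n
elements. -/
theorem exists_adjoin_sub_mem_span {p : ℕ} [hp : Fact p.Prime] {g : Ideal R → ℤ[X]}
    (hg : ∀ P ∈ primesAbove R p, Irreducible ((g P).map (Int.castRingHom (ZMod p))))
    (hmonic : ∀ P ∈ primesAbove R p, ((g P).map (Int.castRingHom (ZMod p))).Monic)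
    (hdeg : ∀ P ∈ primesAbove R p,
      ((g P).map (Int.castRingHom (ZMod p))).natDegree = residueDeg p P)
    (hinj : Set.InjOn (fun P => (g P).map (Int.castRingHom (ZMod p))) (primesAbove R p))
    {x : R} (hx : ∀ P ∈ primesAbove R p, aeval x (g P) ∈ P ∧ aeval x (g P) ∉ P ^ 2) (z : R) :
    ∃ y ∈ Algebra.adjoin ℤ {x}, z - y ∈ span {(p : R)} := by
  set n := Module.finrank ℤ R
  let L : (ZMod p)[X] → ℤ[X] := Function.surjInv (map_zmod_surjective p)
  have hL : ∀ q, (L q).map (Int.castRingHom (ZMod p)) = q :=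
    Function.surjInv_eq (map_zmod_surjective p)
  let Φ : degreeLT (ZMod p) n → R ⧸ span {(p : R)} := fun q =>
    Ideal.Quotient.mk _ (aeval x (L q))
  have hΦ : Function.Injective Φ := by
    intro q q' hqq
    have h1 := Ideal.Quotient.eq.1 hqq
    rw [← map_sub] at h1
    have h2 : (L q - L q').map (Int.castRingHom (ZMod p)) = q - q' := by
      rw [Polynomial.map_sub, hL, hL]
    have h3 := map_zmod_eq_zero_of_aeval_mem_span hg hmonic hdeg hinj hx h1 (by
      rw [h2]; exact mem_degreeLT.1 (q - q').2)
    rw [h2, sub_eq_zero] at h3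
    exact Subtype.ext h3
  have hcR : Nat.card (R ⧸ span {(p : R)}) = p ^ n := Ideal.absNorm_span_natCast p
  have hcL : Nat.card (degreeLT (ZMod p) n) = p ^ n := by
    rw [Nat.card_congr (degreeLTEquiv (ZMod p) n).toEquiv]
    simp
  have : Finite (R ⧸ span {(p : R)}) := Nat.finite_of_card_ne_zero (by
    rw [hcR]; exact pow_ne_zero _ hp.out.ne_zero)
  have hbij := hΦ.bijective_of_nat_card_le (by rw [hcR, hcL])
  obtain ⟨q, hq⟩ := hbij.2 (Ideal.Quotient.mk _ z)
  exact ⟨aeval x (L q), aeval_mem_adjoin_singleton ℤ x, Ideal.Quotient.eq.1 hq.symm⟩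

end Criterion

/-! ### From generation modulo p to the index -/

section Index

variable {K : Type*} [Field K] [NumberField K]

theorem exists_not_dvd_elementIndex_of_adjoin {p : ℕ} (hp : p.Prime) {η : 𝓞 K}
    (h : ∀ z : 𝓞 K, ∃ y ∈ Algebra.adjoin ℤ {η}, z - y ∈ Ideal.span {(p : 𝓞 K)}) :
    ℚ⟮(η : K)⟯ = ⊤ ∧ ¬ p ∣ elementIndex K η := by
  set A := Algebra.adjoin ℤ {η} with hA
  -- Nakayama: some r ≡ 1 mod p satisfies r·A_K ⊆ ℤ[η].
  obtain ⟨r, hr1, hr⟩ := Submodule.exists_sub_one_mem_and_smul_le_of_fg_of_le_sup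
    (I := Ideal.span {(p : ℤ)}) (N := A.toSubmodule) (N' := ⊤) (P := ⊤)
    (Module.finite_def.1 inferInstance) le_rfl (by
      intro z _
      obtain ⟨y, hy, hzy⟩ := h z
      obtain ⟨w, hw⟩ := Ideal.mem_span_singleton.1 hzy
      rw [show z = y + (p : ℤ) • w by rw [zsmul_eq_mul, Int.cast_natCast, ← hw]; ring]
      exact Submodule.add_mem_sup hy
        (Submodule.smul_mem_smul (Ideal.mem_span_singleton_self _) trivial))
  have hrp : ¬ (p : ℤ) ∣ r := by
    intro hd
    have h1 : (p : ℤ) ∣ 1 := by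
      have := dvd_sub hd (Ideal.mem_span_singleton.1 hr1)
      simpa using this
    exact (Nat.prime_iff_prime_int.1 hp).not_dvd_one h1
  have hr0 : r ≠ 0 := fun h0 => hrp (h0 ▸ dvd_zero _)
  have hmem : ∀ z : 𝓞 K, (r : 𝓞 K) * z ∈ A := fun z => by
    have := hr (Submodule.smul_mem_pointwise_smul z r ⊤ trivial)
    simpa using this
  constructor
  · rw [eq_top_iff]
    rintro x -
    obtain ⟨y, d, hd, rfl⟩ := IsFractionRing.div_surjective (A := 𝓞 K) x
    have hsub : ∀ z : 𝓞 K, z ∈ A → (z : K) ∈ ℚ⟮(η : K)⟯ := by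
      intro z hz
      induction hz using Algebra.adjoin_induction with
      | mem y hy =>
        rw [Set.mem_singleton_iff.1 hy]
        exact IntermediateField.mem_adjoin_simple_self ℚ _
      | algebraMap m => simp
      | add y z _ _ hy hz => simpa using add_mem hy hz
      | mul y z _ _ hy hz => simpa using mul_mem hy hz
    have hr0' : (r : K) ≠ 0 := Int.cast_ne_zero.2 hr0
    have h1 := div_mem (hsub _ (hmem y)) (hsub _ (hmem d))
    simpa [mul_div_mul_left _ _ hr0'] using h1
  · intro hd
    -- The index divides |A_K/r| = |r|^n, which is prime to `p`.
    have h1 : elementIndex K η ∣ (Ideal.span {(r : 𝓞 K)}).toAddSubgroup.index := by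
      refine AddSubgroup.index_dvd_of_le fun z hz => ?_
      obtain ⟨w, rfl⟩ := Ideal.mem_span_singleton.1 hz
      exact hmem w
    have h2 : (Ideal.span {(r : 𝓞 K)}).toAddSubgroup.index =
        Ideal.absNorm (Ideal.span {(r : 𝓞 K)}) := rfl
    have h3 : (r : 𝓞 K) = algebraMap ℤ (𝓞 K) r := by simp
    rw [h2, Ideal.absNorm_span_singleton, h3, Algebra.norm_algebraMap, Int.natAbs_pow] at h1
    exact hrp (Int.natCast_dvd.2 (hp.dvd_of_dvd_pow (hd.trans h1)))

theorem exists_not_dvd_elementIndex {p : ℕ} [hp : Fact p.Prime] {g : Ideal (𝓞 K) → (ZMod p)[X]}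
    (hg : ∀ P ∈ primesAbove (𝓞 K) p, Irreducible (g P))
    (hmonic : ∀ P ∈ primesAbove (𝓞 K) p, (g P).Monic)
    (hdeg : ∀ P ∈ primesAbove (𝓞 K) p, (g P).natDegree = residueDeg p P)
    (hinj : Set.InjOn g (primesAbove (𝓞 K) p)) :
    ∃ η : 𝓞 K, ℚ⟮(η : K)⟯ = ⊤ ∧ ¬ p ∣ elementIndex K η := by
  let L : (ZMod p)[X] → ℤ[X] := Function.surjInv (map_zmod_surjective p)
  have hL : ∀ q, (L q).map (Int.castRingHom (ZMod p)) = q :=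
    Function.surjInv_eq (map_zmod_surjective p)
  obtain ⟨η, hη⟩ := exists_forall_aeval_mem_notMem_sq (R := 𝓞 K) (p := p) (fun P => L (g P))
    (by simpa only [hL] using hg) (by simpa only [hL] using hdeg)
  exact ⟨η, exists_not_dvd_elementIndex_of_adjoin hp.out (exists_adjoin_sub_mem_span
    (g := fun P => L (g P)) (by simpa only [hL] using hg) (by simpa only [hL] using hmonic)
    (by simpa only [hL] using hdeg) (by simpa only [hL] using hinj) hη)⟩

theorem not_dvd_fieldIndex_of_not_dvd_elementIndex {p : ℕ} {η : 𝓞 K} (h1 : ℚ⟮(η : K)⟯ = ⊤)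
    (h2 : ¬ p ∣ elementIndex K η) : ¬ p ∣ fieldIndex K := by
  -- A nonzero index bounds the set of common divisors; the supremum of an unbounded set would be
  -- the default value 0, divisible by `p`.
  have h0 : elementIndex K η ≠ 0 := fun h => h2 (h ▸ dvd_zero p)
  have hmem := Nat.sSup_mem (s := {d : ℕ | ∀ η : 𝓞 K, ℚ⟮(η : K)⟯ = ⊤ → d ∣ elementIndex K η})
    ⟨1, fun _ _ => one_dvd _⟩ ⟨elementIndex K η, fun d hd => Nat.le_of_dvd (by omega) (hd η h1)⟩
  exact fun hd => h2 (hd.trans (hmem η h1))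

end Index

/-! ### Supply of irreducible polynomials over F_p -/

section IrreducibleCount

variable {p : ℕ} [hp : Fact p.Prime]

theorem ZMod.exists_monic_irreducible_natDegree_eq (p : ℕ) [Fact p.Prime] {d : ℕ} (hd : d ≠ 0) :
    ∃ q : (ZMod p)[X], q.Monic ∧ Irreducible q ∧ q.natDegree = d := by
  obtain ⟨α, hα⟩ := Field.exists_primitive_element (ZMod p) (GaloisField p d)
  have hint : IsIntegral (ZMod p) α := Algebra.IsIntegral.isIntegral α
  refine ⟨minpoly (ZMod p) α, minpoly.monic hint, minpoly.irreducible hint, ?_⟩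
  rw [← IntermediateField.adjoin.finrank hint, hα, IntermediateField.finrank_top',
    GaloisField.finrank p hd]

theorem Polynomial.Monic.irreducible_of_natDegree_of_eval_ne_zero {F : Type*} [Field F] {q : F[X]}
    (hq : q.Monic) (h2 : 2 ≤ q.natDegree) (h3 : q.natDegree ≤ 3) (h : ∀ x, q.eval x ≠ 0) :
    Irreducible q := by
  rw [hq.irreducible_iff_roots_eq_zero_of_degree_le_three h2 h3]
  refine Multiset.eq_zero_of_forall_notMem fun x hx => h x ?_
  exact (mem_roots'.1 hx).2

theorem ZMod.exists_finset_irreducible_natDegree_two (hp2 : p ≠ 2) :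
    ∃ S : Finset (ZMod p)[X], p ≤ S.card ∧
      ∀ q ∈ S, q.Monic ∧ Irreducible q ∧ q.natDegree = 2 := by
  classical
  obtain ⟨s, hs⟩ := FiniteField.exists_nonsquare (F := ZMod p) (by
    rwa [ringChar.eq (ZMod p) p])
  refine ⟨Finset.univ.image fun c : ZMod p => (X + C c) ^ 2 - C s, ?_, ?_⟩
  · rw [Finset.card_image_of_injective, Finset.card_univ, ZMod.card]
    intro c c' h
    have h1 := congrArg (eval (-c)) h
    simp only [eval_sub, eval_pow, eval_add, eval_X, eval_C] at h1
    have h2 : (c' - c) ^ 2 = 0 := by linear_combination -h1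
    exact (sub_eq_zero.1 (pow_eq_zero_iff two_ne_zero |>.1 h2)).symm
  · intro q hq
    obtain ⟨c, -, rfl⟩ := Finset.mem_image.1 hq
    have hdeg : ((X + C c) ^ 2 - C s).natDegree = 2 := by
      rw [natDegree_sub_C, natDegree_pow, natDegree_X_add_C]
    have hm : ((X + C c) ^ 2 - C s).Monic := by
      refine ((monic_X_add_C c).pow 2).sub_of_left (degree_C_le.trans_lt ?_)
      rw [degree_pow, degree_X_add_C]
      norm_num
    refine ⟨hm, hm.irreducible_of_natDegree_of_eval_ne_zero hdeg.ge (by omega) fun x hx => hs ?_,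
      hdeg⟩
    simp only [eval_sub, eval_pow, eval_add, eval_X, eval_C] at hx
    exact ⟨x + c, by linear_combination -hx⟩

theorem ZMod.exists_finset_irreducible_natDegree_three (hp2 : p ≠ 2) :
    ∃ S : Finset (ZMod p)[X], 2 ≤ S.card ∧
      ∀ q ∈ S, q.Monic ∧ Irreducible q ∧ q.natDegree = 3 := by
  classical
  obtain ⟨q, hm, hirr, hdeg⟩ := ZMod.exists_monic_irreducible_natDegree_eq p three_ne_zero
  have hroot : ∀ x, q.eval x ≠ 0 := fun x hx => by
    have := degree_eq_one_of_irreducible_of_root hirr hx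
    rw [degree_eq_natDegree hirr.ne_zero, hdeg] at this
    norm_num at this
  -- The second cubic is -q(-X); its constant term -q(0) differs from q(0) because p is odd and q(0)
  -- ≠ 0.
  have hd : (-q.comp (-X)).natDegree = 3 := by
    rw [natDegree_neg, natDegree_comp, natDegree_neg, natDegree_X, hdeg]
  have hm' : (-q.comp (-X)).Monic := by
    rw [Monic, leadingCoeff_neg, leadingCoeff_comp (by simp), hm, hdeg]
    simp
    norm_num
  have hirr' := hm'.irreducible_of_natDegree_of_eval_ne_zero (by omega) hd.le fun x hx =>
    hroot (-x) (by simpa using hx)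
  refine ⟨{q, -q.comp (-X)}, ?_, ?_⟩
  · rw [Finset.card_pair]
    intro h
    have h1 := congrArg (eval 0) h
    simp only [eval_neg, eval_comp, eval_X, neg_zero] at h1
    have h2 : (2 : ZMod p) * q.eval 0 = 0 := by linear_combination h1
    have : Fact (2 < p) := ⟨lt_of_le_of_ne hp.out.two_le hp2.symm⟩
    rcases mul_eq_zero.1 h2 with h3 | h3
    · have h4 : ((2 : ℕ) : ZMod p) = 0 := by exact_mod_cast h3
      rw [ZMod.natCast_eq_zero_iff] at h4
      exact hp2 ((Nat.prime_dvd_prime_iff_eq hp.out Nat.prime_two).1 h4)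
    · exact hroot 0 h3
  · intro r hr
    rcases Finset.mem_insert.1 hr with rfl | hr
    · exact ⟨hm, hirr, hdeg⟩
    · rw [Finset.mem_singleton.1 hr]
      exact ⟨hm', hirr', hd⟩

theorem ZMod.exists_finset_irreducible (hp2 : p ≠ 2) {d n : ℕ} (hd : d ≠ 0) (hn : n * d ≤ 7)
    (h1 : d = 1 → n ≤ p) : ∃ S : Finset (ZMod p)[X], n ≤ S.card ∧
      ∀ q ∈ S, q.Monic ∧ Irreducible q ∧ q.natDegree = d := by
  classical
  have hp3 : 3 ≤ p := lt_of_le_of_ne hp.out.two_le hp2.symm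
  have hcases : d = 1 ∨ d = 2 ∨ d = 3 ∨ 4 ≤ d := by omega
  rcases hcases with rfl | rfl | rfl | hd4
  · refine ⟨Finset.univ.image fun c : ZMod p => X - C c, ?_, ?_⟩
    · rw [Finset.card_image_of_injective, Finset.card_univ, ZMod.card]
      · exact h1 rfl
      · intro c c' h
        simpa using h
    · intro q hq
      obtain ⟨c, -, rfl⟩ := Finset.mem_image.1 hq
      exact ⟨monic_X_sub_C c, irreducible_X_sub_C c, natDegree_X_sub_C c⟩
  · obtain ⟨S, hS, h⟩ := ZMod.exists_finset_irreducible_natDegree_two hp2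
    exact ⟨S, by omega, h⟩
  · obtain ⟨S, hS, h⟩ := ZMod.exists_finset_irreducible_natDegree_three hp2
    exact ⟨S, by omega, h⟩
  · obtain ⟨q, hq⟩ := ZMod.exists_monic_irreducible_natDegree_eq p hd
    refine ⟨{q}, ?_, fun r hr => by rwa [Finset.mem_singleton.1 hr]⟩
    rw [Finset.card_singleton]
    by_contra! hc
    have : 2 * 4 ≤ n * d := Nat.mul_le_mul hc hd4
    omega

/-- Polynomials of different degrees are distinct, so the choice is made degree by degree. -/
theorem ZMod.exists_injOn_irreducible (hp2 : p ≠ 2) {ι : Type*} (T : Finset ι) (deg : ι → ℕ)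
    (hpos : ∀ i ∈ T, 1 ≤ deg i) (hsum : ∑ i ∈ T, deg i ≤ 7)
    (hone : (T.filter fun i => deg i = 1).card ≤ p) :
    ∃ g : ι → (ZMod p)[X], Set.InjOn g T ∧
      ∀ i ∈ T, (g i).Monic ∧ Irreducible (g i) ∧ (g i).natDegree = deg i := by
  have key : ∀ d : ℕ, ∃ g : ι → (ZMod p)[X], d ≠ 0 →
      Set.InjOn g (T.filter fun i => deg i = d) ∧
      ∀ i ∈ T.filter fun i => deg i = d, (g i).Monic ∧ Irreducible (g i) ∧ (g i).natDegree = d := by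
    intro d
    rcases eq_or_ne d 0 with rfl | hd
    · exact ⟨fun _ => 0, fun h => absurd rfl h⟩
    have hcard : (T.filter fun i => deg i = d).card * d ≤ 7 := by
      calc (T.filter fun i => deg i = d).card * d
          = ∑ i ∈ T.filter fun i => deg i = d, deg i := by
            rw [Finset.sum_congr rfl fun i hi => (Finset.mem_filter.1 hi).2]
            simp
        _ ≤ ∑ i ∈ T, deg i :=
            Finset.sum_le_sum_of_subset (Finset.filter_subset _ _)
        _ ≤ 7 := hsum
    obtain ⟨S, hS, h⟩ := ZMod.exists_finset_irreducible hp2 hd hcard (by rintro rfl; exact hone)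
    obtain ⟨g, hg1, hg2⟩ := (Finset.finite_toSet (T.filter fun i => deg i = d)
      ).exists_injOn_of_encard_le (t := (S : Set (ZMod p)[X]))
      (by simpa only [Set.encard_coe_eq_coe_finsetCard, Nat.cast_le] using hS)
    exact ⟨g, fun _ => ⟨hg2, fun i hi => h _ (hg1 hi)⟩⟩
  choose g hg using key
  refine ⟨fun i => g (deg i) i, fun i hi j hj hij => ?_, fun i hi => ?_⟩
  · have hdi : deg i ≠ 0 := Nat.one_le_iff_ne_zero.1 (hpos i hi)
    have hdj : deg j ≠ 0 := Nat.one_le_iff_ne_zero.1 (hpos j hj)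
    have hi' : i ∈ T.filter fun k => deg k = deg i := Finset.mem_filter.2 ⟨hi, rfl⟩
    have hj' : j ∈ T.filter fun k => deg k = deg j := Finset.mem_filter.2 ⟨hj, rfl⟩
    have hd : deg i = deg j := by
      rw [← ((hg _ hdi).2 i hi').2.2, ← ((hg _ hdj).2 j hj').2.2]
      exact congrArg natDegree hij
    dsimp only at hij
    rw [← hd] at hj' hij
    exact (hg _ hdi).1 hi' hj' hij
  · exact (hg _ (Nat.one_le_iff_ne_zero.1 (hpos i hi))).2 i (Finset.mem_filter.2 ⟨hi, rfl⟩)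

end IrreducibleCount

/-! ### The norm of m - θ is F(m) -/

section NormOfTranslate

variable {K : Type*} [Field K] [NumberField K]

theorem minpoly_eq_map_of_irreducible {F : ℤ[X]} (hF : Irreducible F) (hm : F.Monic) {θ : K}
    (hθ : aeval θ F = 0) : minpoly ℚ θ = F.map (algebraMap ℤ ℚ) := by
  refine (minpoly.eq_of_irreducible_of_monic
    ((hm.irreducible_iff_irreducible_map_fraction_map).1 hF) ?_ (hm.map _)).symm
  rwa [aeval_map_algebraMap]

theorem finrank_eq_natDegree_of_irreducible {F : ℤ[X]} (hF : Irreducible F) (hm : F.Monic) {θ : K}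
    (hθ : aeval θ F = 0) (hK : ℚ⟮θ⟯ = ⊤) : Module.finrank ℚ K = F.natDegree := by
  have h := IntermediateField.adjoin.finrank (Algebra.IsIntegral.isIntegral (R := ℚ) θ)
  rw [hK, IntermediateField.finrank_top', minpoly_eq_map_of_irreducible hF hm hθ,
    hm.natDegree_map] at h
  exact h

theorem charpoly_lmul_eq_minpoly {θ : K} (hK : ℚ⟮θ⟯ = ⊤) :
    (Algebra.lmul ℚ K θ).charpoly = minpoly ℚ θ := by
  have hint := Algebra.IsIntegral.isIntegral (R := ℚ) θ
  refine eq_of_monic_of_dvd_of_natDegree_le (minpoly.monic hint)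
    (LinearMap.charpoly_monic _) (minpoly.dvd _ _ (Algebra.aeval_self_charpoly_lmul θ)) ?_
  rw [LinearMap.charpoly_natDegree, ← IntermediateField.adjoin.finrank hint, hK,
    IntermediateField.finrank_top']

theorem norm_intCast_sub_eq_eval {F : ℤ[X]} (hF : Irreducible F) (hm : F.Monic) {θ : 𝓞 K}
    (hθ : aeval (θ : K) F = 0) (hK : ℚ⟮(θ : K)⟯ = ⊤) (m : ℤ) :
    Algebra.norm ℤ ((m : 𝓞 K) - θ) = F.eval m := by
  have h : ((Algebra.norm ℤ ((m : 𝓞 K) - θ) : ℤ) : ℚ) = F.eval m := by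
    rw [Algebra.coe_norm_int, Algebra.norm_apply]
    have h1 := LinearMap.eval_charpoly (Algebra.lmul ℚ K θ) (m : ℚ)
    rw [charpoly_lmul_eq_minpoly hK, minpoly_eq_map_of_irreducible hF hm hθ] at h1
    rw [show ((F.eval m : ℤ) : ℚ) = (F.map (algebraMap ℤ ℚ)).eval (m : ℚ) by
      simp [eval_intCast_map], h1]
    congr 2
    ext x
    simp [Algebra.smul_def]
  exact_mod_cast h

end NormOfTranslate

/-! ### Residues at primes of degree one -/

section PrimesAbove

variable {R : Type*} [CommRing R] [IsDedekindDomain R] [CharZero R] {p : ℕ}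

theorem idealOrd_intCast (hp : p.Prime) {P : Ideal R} (hP : P ∈ primesAbove R p)
    {m m' : ℤ} {v : ℕ} (hm : m = p ^ v * m') (hm' : ¬ (p : ℤ) ∣ m') :
    idealOrd P (m : R) = v * idealOrd P (p : R) := by
  obtain ⟨hPr, hpP⟩ := (mem_primesAbove_iff hp).1 hP
  have hp0 : (p : R) ≠ 0 := Nat.cast_ne_zero.2 hp.ne_zero
  have h0 : m' ≠ 0 := fun h => hm' (h ▸ dvd_zero _)
  have h0' : (m' : R) ≠ 0 := Int.cast_ne_zero.2 h0
  have h1 : idealOrd P (m' : R) = 0 := by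
    by_contra h
    have h2 : (m' : R) ∈ P := by
      simpa using (le_idealOrd_iff hPr h0' 1).1 (Nat.one_le_iff_ne_zero.2 h)
    obtain ⟨u, v, huv⟩ := ((Nat.prime_iff_prime_int.1 hp).coprime_iff_not_dvd).2 hm'
    refine (Ideal.isPrime_of_prime hPr).ne_top ((Ideal.eq_top_iff_one P).2 ?_)
    have h3 := congrArg (Int.cast (R := R)) huv
    push_cast at h3
    rw [← h3]
    exact add_mem (P.mul_mem_left _ hpP) (P.mul_mem_left _ h2)
  have h2 : (m : R) = p ^ v * m' := by rw [hm]; push_cast; ring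
  rw [h2, idealOrd_mul P (pow_ne_zero _ hp0) h0', idealOrd_pow P hp0, h1, add_zero]

theorem natCast_pow_mem_pow (hp : p.Prime) {P : Ideal R} (hP : P ∈ primesAbove R p) (k : ℕ) :
    (p : R) ^ k ∈ P ^ (k * idealOrd P (p : R)) := by
  obtain ⟨hPr, -⟩ := (mem_primesAbove_iff hp).1 hP
  have hp0 : (p : R) ≠ 0 := Nat.cast_ne_zero.2 hp.ne_zero
  rw [← le_idealOrd_iff hPr (pow_ne_zero k hp0), idealOrd_pow P hp0]

variable [Module.Free ℤ R] [Module.Finite ℤ R]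

theorem exists_natCast_sub_mem_of_residueDeg_eq_one (hp : p.Prime) {P : Ideal R}
    (hP : P ∈ primesAbove R p) (h1 : residueDeg p P = 1) (x : R) : ∃ c < p, x - (c : R) ∈ P := by
  obtain ⟨hPr, hpP⟩ := (mem_primesAbove_iff hp).1 hP
  have hcard : Nat.card (R ⧸ P) = p := by
    have := absNorm_eq_pow_residueDeg hp hP
    rwa [h1, pow_one] at this
  have hfin : Finite (R ⧸ P) := Nat.finite_of_card_ne_zero (by rw [hcard]; exact hp.ne_zero)
  have : Fact p.Prime := ⟨hp⟩
  have := Ideal.isPrime_of_prime hPr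
  have hp0 : (p : R ⧸ P) = 0 := by
    have := Ideal.Quotient.eq_zero_iff_mem.2 hpP
    simpa using this
  have : CharP (R ⧸ P) p := (CharP.charP_iff_prime_eq_zero hp).2 hp0
  have hbij := (ZMod.castHom (dvd_refl p) (R ⧸ P)).injective.bijective_of_nat_card_le
    (by rw [hcard, Nat.card_zmod])
  obtain ⟨c, hc⟩ := hbij.2 (Ideal.Quotient.mk P x)
  refine ⟨c.val, c.val_lt, ?_⟩
  rw [← Ideal.Quotient.eq_zero_iff_mem, map_sub, ← hc, map_natCast, ZMod.castHom_apply,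
    ZMod.natCast_val, sub_self]

/-- P^(ke)/P^(ke+1) is a line over R/P = F_p spanned by p^k; `c` is the coordinate of `x`. -/
theorem exists_sub_mul_pow_mem_pow_succ (hp : p.Prime) {P : Ideal R}
    (hP : P ∈ primesAbove R p) (h1 : residueDeg p P = 1) {x : R} {k : ℕ}
    (hx : x ∈ P ^ (k * idealOrd P (p : R))) :
    ∃ c < p, x - (c : R) * p ^ k ∈ P ^ (k * idealOrd P (p : R) + 1) := by
  obtain ⟨hPr, hpP⟩ := (mem_primesAbove_iff hp).1 hP
  have hp0 : (p : R) ≠ 0 := Nat.cast_ne_zero.2 hp.ne_zero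
  have := Ideal.isPrime_of_prime hPr
  have hnot : (p : R) ^ k ∉ P ^ (k * idealOrd P (p : R) + 1) := by
    rw [← le_idealOrd_iff hPr (pow_ne_zero k hp0), idealOrd_pow P hp0]
    omega
  obtain ⟨d, ε, hε, hd⟩ := Ideal.exists_mul_add_mem_pow_succ hPr.ne_zero _ _
    (natCast_pow_mem_pow hp hP k) hnot hx
  obtain ⟨c, hc, hcd⟩ := exists_natCast_sub_mem_of_residueDeg_eq_one hp hP h1 d
  refine ⟨c, hc, ?_⟩
  have : x - (c : R) * p ^ k = p ^ k * (d - c) + ε := by rw [← hd]; ring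
  rw [this]
  refine add_mem ?_ hε
  rw [pow_succ]
  exact Ideal.mul_mem_mul (natCast_pow_mem_pow hp hP k) hcd

end PrimesAbove

/-! ### Newton polygon of the trinomial and residues along a side -/

section Trinomial

variable {R : Type*} [CommRing R] [IsDedekindDomain R] [CharZero R] {p : ℕ}

/-- One-sided case: the point (5, va) is absent or not below the segment from (0, vb) to (7, 0),
which has height 2vb/7 there. -/
theorem seven_mul_idealOrd_eq (hp : p.Prime) {a b b' : ℤ} {va vb : ℕ} {θ : R}
    (hθ0 : θ ≠ 0) (hθ : θ ^ 7 + a * θ ^ 5 + b = 0) (hb : b = p ^ vb * b') (hb' : ¬ (p : ℤ) ∣ b')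
    (ha : a = 0 ∨ ∃ a' : ℤ, a = p ^ va * a' ∧ ¬ (p : ℤ) ∣ a') (hab : a = 0 ∨ 2 * vb ≤ 7 * va)
    {P : Ideal R} (hP : P ∈ primesAbove R p) :
    7 * idealOrd P θ = vb * idealOrd P (p : R) := by
  obtain ⟨hPr, hpP⟩ := (mem_primesAbove_iff hp).1 hP
  have hb0 : b ≠ 0 := by
    rw [hb]
    exact mul_ne_zero (pow_ne_zero _ (by exact_mod_cast hp.ne_zero)) fun h => hb' (h ▸ dvd_zero _)
  have hbR : (b : R) ≠ 0 := Int.cast_ne_zero.2 hb0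
  have h7 := pow_ne_zero 7 hθ0
  have h5 := pow_ne_zero 5 hθ0
  rcases eq_or_ne a 0 with rfl | ha0
  · have h1 : θ ^ 7 = ((-b : ℤ) : R) := by push_cast at hθ ⊢; linear_combination hθ
    rw [← idealOrd_pow P hθ0, h1, idealOrd_intCast hp hP (m' := -b') (v := vb)
      (by rw [hb]; ring) (by rwa [dvd_neg])]
  · obtain ⟨a', ha, ha'⟩ := ha.resolve_left ha0
    have haR : (a : R) ≠ 0 := Int.cast_ne_zero.2 ha0
    have h75 := mul_ne_zero haR h5
    have m1 := min_le_idealOrd_of_add_add_eq_zero hPr h7 h75 hbR hθ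
    have m2 := min_le_idealOrd_of_add_add_eq_zero hPr h75 h7 hbR (by linear_combination hθ)
    have m3 := min_le_idealOrd_of_add_add_eq_zero hPr hbR h7 h75 (by linear_combination hθ)
    rw [idealOrd_mul P haR h5, idealOrd_pow P hθ0, idealOrd_pow P hθ0,
      idealOrd_intCast hp hP ha ha', idealOrd_intCast hp hP hb hb'] at m1 m2 m3
    have h2 : 2 * (vb * idealOrd P (p : R)) ≤ 7 * (va * idealOrd P (p : R)) := by
      rw [← mul_assoc, ← mul_assoc]
      exact Nat.mul_le_mul_right _ (hab.resolve_left ha0)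
    omega

theorem two_mul_idealOrd_eq_or (hp : p.Prime) {a b a' b' : ℤ} {va vb : ℕ} {θ : R}
    (hθ0 : θ ≠ 0) (hθ : θ ^ 7 + a * θ ^ 5 + b = 0) (hb : b = p ^ vb * b') (hb' : ¬ (p : ℤ) ∣ b')
    (ha : a = p ^ va * a') (ha' : ¬ (p : ℤ) ∣ a') (hab : 7 * va < 2 * vb)
    {P : Ideal R} (hP : P ∈ primesAbove R p) :
    2 * idealOrd P θ = va * idealOrd P (p : R) ∨
      5 * idealOrd P θ = (vb - va) * idealOrd P (p : R) := by
  obtain ⟨hPr, hpP⟩ := (mem_primesAbove_iff hp).1 hP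
  have hpz : (p : ℤ) ≠ 0 := by exact_mod_cast hp.ne_zero
  have hbR : (b : R) ≠ 0 := Int.cast_ne_zero.2 (by
    rw [hb]
    exact mul_ne_zero (pow_ne_zero _ hpz) fun h => hb' (h ▸ dvd_zero _))
  have haR : (a : R) ≠ 0 := Int.cast_ne_zero.2 (by
    rw [ha]
    exact mul_ne_zero (pow_ne_zero _ hpz) fun h => ha' (h ▸ dvd_zero _))
  have h7 := pow_ne_zero 7 hθ0
  have h5 := pow_ne_zero 5 hθ0
  have h75 := mul_ne_zero haR h5
  have m1 := min_le_idealOrd_of_add_add_eq_zero hPr h7 h75 hbR hθ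
  have m2 := min_le_idealOrd_of_add_add_eq_zero hPr h75 h7 hbR (by linear_combination hθ)
  have m3 := min_le_idealOrd_of_add_add_eq_zero hPr hbR h7 h75 (by linear_combination hθ)
  rw [idealOrd_mul P haR h5, idealOrd_pow P hθ0, idealOrd_pow P hθ0,
    idealOrd_intCast hp hP ha ha', idealOrd_intCast hp hP hb hb'] at m1 m2 m3
  have he := one_le_idealOrd_of_mem_primesAbove hp hP
  have h2 : 7 * (va * idealOrd P (p : R)) < 2 * (vb * idealOrd P (p : R)) := by
    rw [← mul_assoc, ← mul_assoc]
    exact Nat.mul_lt_mul_of_pos_right hab he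
  rw [Nat.sub_mul]
  omega

variable [Module.Free ℤ R] [Module.Finite ℤ R]

theorem factorization_natAbs_pow_mul (hp : p.Prime) {m : ℤ} (hm : m ≠ 0) (v : ℕ) :
    ((p : ℤ) ^ v * m).natAbs.factorization p = v + m.natAbs.factorization p := by
  rw [Int.natAbs_mul, Int.natAbs_pow, Int.natAbs_natCast, Nat.factorization_mul
    (pow_ne_zero _ hp.ne_zero) (Int.natAbs_ne_zero.2 hm), Finsupp.add_apply,
    hp.factorization_pow, Finsupp.single_eq_same]

theorem sum_residueDeg_mul_idealOrd_root (hp : p.Prime) {a b b' : ℤ} {vb : ℕ} {θ : R}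
    (hθ0 : θ ≠ 0) (hnorm : ∀ m : ℤ, Algebra.norm ℤ ((m : R) - θ) = m ^ 7 + a * m ^ 5 + b)
    (hb : b = p ^ vb * b') (hb' : ¬ (p : ℤ) ∣ b') :
    ∑ P ∈ primesAbove R p, residueDeg p P * idealOrd P θ = vb := by
  rw [← factorization_absNorm_span hp hθ0]
  have h0 := hnorm 0
  have hb0 : b' ≠ 0 := fun h => hb' (h ▸ dvd_zero _)
  rw [Int.cast_zero, zero_sub] at h0
  rw [← Ideal.span_singleton_neg, Ideal.absNorm_span_singleton, h0]
  norm_num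
  rw [hb, factorization_natAbs_pow_mul hp hb0, Nat.factorization_eq_zero_of_not_dvd, add_zero]
  rwa [← Int.natCast_dvd]

/-- Compare norms: F(cp^k) = p^vb·G(c) has p-order ∑ f·v_P(cp^k - θ), while ∑ f·v_P(θ) = vb. No term
drops, by `hle`, and each P in `T` gains at least 1. -/
theorem pow_card_dvd_of_residue (hp : p.Prime) {a b a' b' c : ℤ} {vb k r : ℕ} {θ : R}
    (hθ0 : θ ≠ 0) (hnorm : ∀ m : ℤ, Algebra.norm ℤ ((m : R) - θ) = m ^ 7 + a * m ^ 5 + b)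
    (hne : ∀ m : ℤ, m ^ 7 + a * m ^ 5 + b ≠ 0)
    (hb : b = p ^ vb * b') (hb' : ¬ (p : ℤ) ∣ b') (ha : a * p ^ (5 * k) = p ^ vb * a')
    (hk : 7 * k = vb + r)
    (hle : ∀ P ∈ primesAbove R p, idealOrd P θ ≤ k * idealOrd P (p : R))
    (T : Finset (Ideal R)) (hT : T ⊆ primesAbove R p)
    (hTw : ∀ P ∈ T, idealOrd P θ = k * idealOrd P (p : R))
    (hTc : ∀ P ∈ T, θ - (c : R) * p ^ k ∈ P ^ (k * idealOrd P (p : R) + 1)) :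
    (p : ℤ) ^ T.card ∣ p ^ r * c ^ 7 + a' * c ^ 5 + b' := by
  classical
  set G := (p : ℤ) ^ r * c ^ 7 + a' * c ^ 5 + b'
  have hG : (c * p ^ k) ^ 7 + a * (c * p ^ k) ^ 5 + b = p ^ vb * G := by
    have h1 : ((p : ℤ) ^ k) ^ 7 = p ^ vb * p ^ r := by
      rw [← pow_mul, mul_comm k 7, hk, pow_add]
    have h2 : a * ((p : ℤ) ^ k) ^ 5 = p ^ vb * a' := by
      rw [← pow_mul, mul_comm k 5, ha]
    rw [mul_pow, mul_pow, h1, hb]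
    linear_combination c ^ 5 * h2
  have hGne : G ≠ 0 := fun h => hne (c * p ^ k) (by rw [hG, h, mul_zero])
  have hn := hnorm (c * p ^ k)
  have hx0 : ((c * p ^ k : ℤ) : R) - θ ≠ 0 := fun h => by
    rw [h, Algebra.norm_zero] at hn
    exact hne _ hn.symm
  have hsum := factorization_absNorm_span hp hx0
  rw [Ideal.absNorm_span_singleton, hn, hG, factorization_natAbs_pow_mul hp hGne] at hsum
  have hmem : ∀ P ∈ primesAbove R p, idealOrd P θ ≤ idealOrd P (((c * p ^ k : ℤ) : R) - θ) := by
    intro P hP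
    have hPr := ((mem_primesAbove_iff hp).1 hP).1
    rw [le_idealOrd_iff hPr hx0]
    refine sub_mem ?_ ((le_idealOrd_iff hPr hθ0 _).1 le_rfl)
    push_cast
    exact Ideal.mul_mem_left _ _ (Ideal.pow_le_pow_right (hle P hP) (natCast_pow_mem_pow hp hP k))
  have hlow : vb + T.card ≤ ∑ P ∈ primesAbove R p,
      residueDeg p P * idealOrd P (((c * p ^ k : ℤ) : R) - θ) := by
    have hcard : T.card = ∑ P ∈ primesAbove R p, if P ∈ T then 1 else 0 := by
      rw [Finset.sum_boole, Finset.filter_mem_eq_inter, Finset.inter_eq_right.2 hT, Nat.cast_id]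
    rw [← sum_residueDeg_mul_idealOrd_root hp hθ0 hnorm hb hb', hcard, ← Finset.sum_add_distrib]
    refine Finset.sum_le_sum fun P hP => ?_
    split_ifs with hPT
    · have hPr := ((mem_primesAbove_iff hp).1 hP).1
      have h1 : idealOrd P θ + 1 ≤ idealOrd P (((c * p ^ k : ℤ) : R) - θ) := by
        rw [hTw P hPT, le_idealOrd_iff hPr hx0, ← neg_mem_iff, neg_sub]
        push_cast
        exact hTc P hPT
      have h2 := one_le_residueDeg hp hP
      calc residueDeg p P * idealOrd P θ + 1
          ≤ residueDeg p P * idealOrd P θ + residueDeg p P := by omega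
        _ = residueDeg p P * (idealOrd P θ + 1) := by ring
        _ ≤ _ := Nat.mul_le_mul_left _ h1
    · exact Nat.mul_le_mul_left _ (hmem P hP)
  have h3 : T.card ≤ G.natAbs.factorization p := by omega
  rw [← hp.pow_dvd_iff_le_factorization (Int.natAbs_ne_zero.2 hGne)] at h3
  rw [← Int.natAbs_dvd_natAbs, Int.natAbs_pow, Int.natAbs_natCast]
  exact h3

theorem exists_card_le_sum_residue (hp : p.Prime) {a b a' b' : ℤ} {vb k r : ℕ} {θ : R}
    (hθ0 : θ ≠ 0) (hnorm : ∀ m : ℤ, Algebra.norm ℤ ((m : R) - θ) = m ^ 7 + a * m ^ 5 + b)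
    (hne : ∀ m : ℤ, m ^ 7 + a * m ^ 5 + b ≠ 0)
    (hb : b = p ^ vb * b') (hb' : ¬ (p : ℤ) ∣ b') (ha : a * p ^ (5 * k) = p ^ vb * a')
    (hk : 7 * k = vb + r)
    (hle : ∀ P ∈ primesAbove R p, idealOrd P θ ≤ k * idealOrd P (p : R)) :
    ∃ N : ℕ → ℕ,
      (∀ (c : ℕ) (t : ℤ), (p : ℤ) ^ N c ∣ p ^ r * (c + p * t) ^ 7 + a' * (c + p * t) ^ 5 + b') ∧
      ((primesAbove R p).filter fun P =>
        residueDeg p P = 1 ∧ idealOrd P θ = k * idealOrd P (p : R)).card ≤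
          ∑ c ∈ Finset.range p, N c := by
  classical
  let T : ℕ → Finset (Ideal R) := fun c => (primesAbove R p).filter fun P =>
    idealOrd P θ = k * idealOrd P (p : R) ∧
      θ - (c : R) * p ^ k ∈ P ^ (k * idealOrd P (p : R) + 1)
  refine ⟨fun c => (T c).card, fun c t => ?_, ?_⟩
  · refine pow_card_dvd_of_residue hp hθ0 hnorm hne hb hb' ha hk hle (T c)
      (Finset.filter_subset _ _) (fun P hP => (Finset.mem_filter.1 hP).2.1) fun P hP => ?_
    obtain ⟨hP, -, hc⟩ := Finset.mem_filter.1 hP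
    -- Changing c by a multiple of p does not affect the congruence, so one `N c` serves every lift.
    have h1 : (p : R) ^ (k + 1) ∈ P ^ (k * idealOrd P (p : R) + 1) := by
      rw [pow_succ, pow_succ]
      exact Ideal.mul_mem_mul (natCast_pow_mem_pow hp hP k) ((mem_primesAbove_iff hp).1 hP).2
    have h2 : θ - ((c + p * t : ℤ) : R) * p ^ k =
        (θ - (c : R) * p ^ k) - t * p ^ (k + 1) := by
      push_cast; ring
    rw [h2]
    exact sub_mem hc (Ideal.mul_mem_left _ _ h1)
  · refine le_trans (Finset.card_le_card ?_) Finset.card_biUnion_le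
    intro P hP
    obtain ⟨hP, h1, hw⟩ := Finset.mem_filter.1 hP
    have hPr := ((mem_primesAbove_iff hp).1 hP).1
    obtain ⟨c, hc, hm⟩ := exists_sub_mul_pow_mem_pow_succ hp hP h1
      ((le_idealOrd_iff hPr hθ0 _).1 hw.ge)
    exact Finset.mem_biUnion.2 ⟨c, Finset.mem_range.2 hc, Finset.mem_filter.2 ⟨hP, hw, hm⟩⟩

end Trinomial

/-! ### Finite-difference bounds for p = 3 and p = 5 -/

section Bounds

theorem card_le_three_of_pow_dvd {a b : ℤ} (hb : ¬ (3 : ℤ) ∣ b) {N : ℕ → ℕ}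
    (h : ∀ (c : ℕ) (t : ℤ), (3 : ℤ) ^ N c ∣ 3 ^ 0 * (c + 3 * t) ^ 7 + a * (c + 3 * t) ^ 5 + b) :
    ∑ c ∈ Finset.range 3, N c ≤ 3 := by
  have key : ∀ (c j : ℕ) (t : ℤ), j ≤ N c →
      (3 : ℤ) ^ j ∣ 3 ^ 0 * (c + 3 * t) ^ 7 + a * (c + 3 * t) ^ 5 + b :=
    fun c j t hj => (pow_dvd_pow 3 hj).trans (h c t)
  have h0 : ¬ 1 ≤ N 0 := fun hj => by
    have := key 0 1 0 hj
    norm_num at this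
    exact hb this
  have h12 : ¬ (1 ≤ N 1 ∧ 1 ≤ N 2) := fun ⟨hj, hj'⟩ => by
    have h1 := key 1 1 0 hj
    have h2 := key 2 1 0 hj'
    norm_num at h1 h2
    omega
  -- With G = x^7 + ax^5 + b, the values at 1 and 1 ± 3 give 3 ∣ G'(1) = 7 + 5a and 3 ∣ G''(1) = 42
  -- + 20a, which are incompatible.
  have h1 : ¬ 3 ≤ N 1 := fun hj => by
    have h1 := key 1 3 0 hj
    have h2 := key 1 3 1 hj
    have h3 := key 1 3 (-1) hj
    norm_num at h1 h2 h3
    omega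
  have h2 : ¬ 3 ≤ N 2 := fun hj => by
    have h1 := key 2 3 0 hj
    have h2 := key 2 3 1 hj
    have h3 := key 2 3 (-1) hj
    norm_num at h1 h2 h3
    omega
  simp only [Finset.sum_range_succ, Finset.sum_range_zero]
  omega

theorem card_le_one_of_pow_dvd_three {a b : ℤ} {r : ℕ} (hr : r ≠ 0)
    (hb : ¬ (3 : ℤ) ∣ b) {N : ℕ → ℕ}
    (h : ∀ (c : ℕ) (t : ℤ), (3 : ℤ) ^ N c ∣ 3 ^ r * (c + 3 * t) ^ 7 + a * (c + 3 * t) ^ 5 + b) :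
    ∑ c ∈ Finset.range 3, N c ≤ 1 := by
  obtain ⟨s, rfl⟩ := Nat.exists_eq_succ_of_ne_zero hr
  obtain ⟨π, hπ⟩ : ∃ π : ℤ, (3 : ℤ) ^ s.succ = 3 * π := ⟨3 ^ s, pow_succ' _ _⟩
  rw [hπ] at h
  clear hπ hr
  have key : ∀ (c j : ℕ) (t : ℤ), j ≤ N c →
      (3 : ℤ) ^ j ∣ 3 * π * (c + 3 * t) ^ 7 + a * (c + 3 * t) ^ 5 + b :=
    fun c j t hj => (pow_dvd_pow 3 hj).trans (h c t)
  have h0 : ¬ 1 ≤ N 0 := fun hj => by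
    have := key 0 1 0 hj
    norm_num at this
    exact hb this
  have h12 : ¬ (1 ≤ N 1 ∧ 1 ≤ N 2) := fun ⟨hj, hj'⟩ => by
    have h1 := key 1 1 0 hj
    have h2 := key 2 1 0 hj'
    norm_num at h1 h2
    omega
  have h1 : ¬ 2 ≤ N 1 := fun hj => by
    have h1 := key 1 2 0 hj
    have h2 := key 1 2 1 hj
    norm_num at h1 h2
    omega
  have h2 : ¬ 2 ≤ N 2 := fun hj => by
    have h1 := key 2 2 0 hj
    have h2 := key 2 2 1 hj
    norm_num at h1 h2
    omega
  simp only [Finset.sum_range_succ, Finset.sum_range_zero]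
  omega

theorem card_le_four_of_pow_dvd {a b : ℤ} (hb : ¬ (5 : ℤ) ∣ b) {N : ℕ → ℕ}
    (h : ∀ (c : ℕ) (t : ℤ), (5 : ℤ) ^ N c ∣ 5 ^ 0 * (c + 5 * t) ^ 7 + a * (c + 5 * t) ^ 5 + b) :
    ∑ c ∈ Finset.range 5, N c ≤ 4 := by
  have key : ∀ (c j : ℕ) (t : ℤ), j ≤ N c →
      (5 : ℤ) ^ j ∣ 5 ^ 0 * (c + 5 * t) ^ 7 + a * (c + 5 * t) ^ 5 + b :=
    fun c j t hj => (pow_dvd_pow 5 hj).trans (h c t)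
  have h0 : ¬ 1 ≤ N 0 := fun hj => by
    have := key 0 1 0 hj
    norm_num at this
    exact hb this
  -- Modulo 5 the derivative is 2c^6, so every nonzero root is simple.
  have h1 : ¬ 2 ≤ N 1 := fun hj => by
    have h1 := key 1 2 0 hj
    have h2 := key 1 2 1 hj
    norm_num at h1 h2
    omega
  have h2 : ¬ 2 ≤ N 2 := fun hj => by
    have h1 := key 2 2 0 hj
    have h2 := key 2 2 1 hj
    norm_num at h1 h2
    omega
  have h3 : ¬ 2 ≤ N 3 := fun hj => by
    have h1 := key 3 2 0 hj
    have h2 := key 3 2 1 hj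
    norm_num at h1 h2
    omega
  have h4 : ¬ 2 ≤ N 4 := fun hj => by
    have h1 := key 4 2 0 hj
    have h2 := key 4 2 1 hj
    norm_num at h1 h2
    omega
  simp only [Finset.sum_range_succ, Finset.sum_range_zero]
  omega

/-- The derivative of G is divisible by 5, so 5^4 is needed. Second and first differences give a ≡
2πc² and a ≡ -2πc² mod 5, hence 5 ∣ a and then 5 ∣ b. -/
theorem not_dvd_of_pow_dvd_five {a b c π : ℤ} (hb : ¬ (5 : ℤ) ∣ b) (hc : ¬ (5 : ℤ) ∣ c)
    (h0 : (5 : ℤ) ^ 4 ∣ 5 * π * c ^ 7 + a * c ^ 5 + b)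
    (h1 : (5 : ℤ) ^ 4 ∣ 5 * π * (c + 5) ^ 7 + a * (c + 5) ^ 5 + b)
    (h2 : (5 : ℤ) ^ 4 ∣ 5 * π * (c - 5) ^ 7 + a * (c - 5) ^ 5 + b) : False := by
  have h5 : Prime (5 : ℤ) := by norm_num
  have hs : (5 : ℤ) ∣ c ^ 3 * (2 * a + π * c ^ 2) := by
    obtain ⟨k0, h0⟩ := h0
    obtain ⟨k1, h1⟩ := h1
    obtain ⟨k2, h2⟩ := h2
    have : 250 * (c ^ 3 * (2 * a + π * c ^ 2)) = 5 ^ 4 * (k1 + k2 - 2 * k0 - (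
      2 * π * (4 * c ^ 5 + 35 * 5 * c ^ 3 + 7 * 125 * c) + 10 * a * c)) := by
      linear_combination h1 + h2 - 2 * h0
    omega
  have hd : (5 : ℤ) ∣ c ^ 4 * (a + 7 * π * c ^ 2) := by
    obtain ⟨k1, h1⟩ := h1
    obtain ⟨k2, h2⟩ := h2
    have : 50 * (c ^ 4 * (a + 7 * π * c ^ 2)) = 5 ^ 4 * (k1 - k2 - (
      2 * π * (35 * c ^ 4 + 21 * 25 * c ^ 2 + 625) + a * (4 * c ^ 2 + 10))) := by
      linear_combination h1 - h2
    omega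
  have hs' := (h5.dvd_or_dvd hs).resolve_left fun h => hc (h5.dvd_of_dvd_pow h)
  have hd' := (h5.dvd_or_dvd hd).resolve_left fun h => hc (h5.dvd_of_dvd_pow h)
  have ha : (5 : ℤ) ∣ a := by
    rw [mul_assoc] at hd'
    omega
  refine hb ?_
  have h6 : b = (5 * π * c ^ 7 + a * c ^ 5 + b) - 5 * (π * c ^ 7) - a * c ^ 5 := by ring
  rw [h6]
  exact dvd_sub (dvd_sub ((dvd_pow_self 5 four_ne_zero).trans h0) (dvd_mul_right _ _))
    (ha.mul_right _)

theorem card_le_three_of_pow_dvd_five {a b : ℤ} {r : ℕ} (hr : r ≠ 0)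
    (hb : ¬ (5 : ℤ) ∣ b) {N : ℕ → ℕ}
    (h : ∀ (c : ℕ) (t : ℤ), (5 : ℤ) ^ N c ∣ 5 ^ r * (c + 5 * t) ^ 7 + a * (c + 5 * t) ^ 5 + b) :
    ∑ c ∈ Finset.range 5, N c ≤ 3 := by
  obtain ⟨s, rfl⟩ := Nat.exists_eq_succ_of_ne_zero hr
  obtain ⟨π, hπ⟩ : ∃ π : ℤ, (5 : ℤ) ^ s.succ = 5 * π := ⟨5 ^ s, pow_succ' _ _⟩
  rw [hπ] at h
  clear hπ hr
  have key : ∀ (c j : ℕ) (t : ℤ), j ≤ N c →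
      (5 : ℤ) ^ j ∣ 5 * π * (c + 5 * t) ^ 7 + a * (c + 5 * t) ^ 5 + b :=
    fun c j t hj => (pow_dvd_pow 5 hj).trans (h c t)
  have h0 : ¬ 1 ≤ N 0 := fun hj => by
    have := key 0 1 0 hj
    norm_num at this
    exact hb this
  have h1 : ¬ 4 ≤ N 1 := fun hj =>
    not_dvd_of_pow_dvd_five hb (c := 1) (by norm_num)
      (by simpa using key 1 4 0 hj) (by simpa using key 1 4 1 hj)
      (by simpa [sub_eq_add_neg] using key 1 4 (-1) hj)
  have h2 : ¬ 4 ≤ N 2 := fun hj =>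
    not_dvd_of_pow_dvd_five hb (c := 2) (by norm_num)
      (by simpa using key 2 4 0 hj) (by simpa using key 2 4 1 hj)
      (by simpa [sub_eq_add_neg] using key 2 4 (-1) hj)
  have h3 : ¬ 4 ≤ N 3 := fun hj =>
    not_dvd_of_pow_dvd_five hb (c := 3) (by norm_num)
      (by simpa using key 3 4 0 hj) (by simpa using key 3 4 1 hj)
      (by simpa [sub_eq_add_neg] using key 3 4 (-1) hj)
  have h4 : ¬ 4 ≤ N 4 := fun hj =>
    not_dvd_of_pow_dvd_five hb (c := 4) (by norm_num)
      (by simpa using key 4 4 0 hj) (by simpa using key 4 4 1 hj)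
      (by simpa [sub_eq_add_neg] using key 4 4 (-1) hj)
  have h5 : Prime (5 : ℤ) := by norm_num
  have hpair : ∀ c d : ℕ, ¬ (5 : ℤ) ∣ (c : ℤ) ^ 5 - (d : ℤ) ^ 5 → ¬ (1 ≤ N c ∧ 1 ≤ N d) := by
    rintro c d hcd ⟨hc, hd⟩
    obtain ⟨u, hu⟩ := key c 1 0 hc
    obtain ⟨v, hv⟩ := key d 1 0 hd
    have h6 : (5 : ℤ) ∣ a * ((c : ℤ) ^ 5 - (d : ℤ) ^ 5) :=
      ⟨u - v - π * c ^ 7 + π * d ^ 7, by linear_combination hu - hv⟩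
    obtain ⟨w, hw⟩ := (h5.dvd_or_dvd h6).resolve_right hcd
    exact hb ⟨u - π * c ^ 7 - w * c ^ 5, by rw [hw] at hu; linear_combination hu⟩
  have q12 := hpair 1 2 (by norm_num)
  have q13 := hpair 1 3 (by norm_num)
  have q14 := hpair 1 4 (by norm_num)
  have q23 := hpair 2 3 (by norm_num)
  have q24 := hpair 2 4 (by norm_num)
  have q34 := hpair 3 4 (by norm_num)
  clear hb
  simp only [Finset.sum_range_succ, Finset.sum_range_zero]
  omega

end Bounds

/-! ### At most p primes of degree one for p = 3, 5 -/

section DegreeOnePrimes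

variable {R : Type*} [CommRing R] [IsDedekindDomain R] [CharZero R] [Module.Free ℤ R]
  [Module.Finite ℤ R] {p : ℕ}

theorem mul_card_le_of_dvd_idealOrd (hp : p.Prime) {d : ℕ} (T : Finset (Ideal R))
    (hT : T ⊆ primesAbove R p) (hd : ∀ P ∈ T, d ∣ idealOrd P (p : R)) :
    d * T.card ≤ Module.finrank ℤ R := by
  rw [← sum_residueDeg_mul_idealOrd hp, mul_comm, ← smul_eq_mul, ← Finset.sum_const]
  refine le_trans (Finset.sum_le_sum fun P hP => ?_) (Finset.sum_le_sum_of_subset hT)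
  have h1 := one_le_residueDeg hp (hT hP)
  have h2 := Nat.le_of_dvd (one_le_idealOrd_of_mem_primesAbove hp (hT hP)) (hd P hP)
  exact h2.trans (Nat.le_mul_of_pos_left _ h1)

theorem card_filter_two_mul_idealOrd_le_two (hp : p.Prime) {a b b' : ℤ} {va vb : ℕ} {θ : R}
    (hrank : Module.finrank ℤ R = 7) (hθ0 : θ ≠ 0)
    (hnorm : ∀ m : ℤ, Algebra.norm ℤ ((m : R) - θ) = m ^ 7 + a * m ^ 5 + b)
    (hb : b = p ^ vb * b') (hb' : ¬ (p : ℤ) ∣ b') (hab : 7 * va < 2 * vb)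
    (hor : ∀ P ∈ primesAbove R p, 2 * idealOrd P θ = va * idealOrd P (p : R) ∨
      5 * idealOrd P θ = (vb - va) * idealOrd P (p : R)) :
    ((primesAbove R p).filter fun P => 2 * idealOrd P θ = va * idealOrd P (p : R)).card ≤ 2 := by
  set A := (primesAbove R p).filter fun P => 2 * idealOrd P θ = va * idealOrd P (p : R) with hA
  set B := (primesAbove R p).filter fun P => ¬ 2 * idealOrd P θ = va * idealOrd P (p : R) with hB
  have h1 : ∑ P ∈ A, residueDeg p P * idealOrd P (p : R) +
      ∑ P ∈ B, residueDeg p P * idealOrd P (p : R) = 7 := by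
    rw [hA, hB, Finset.sum_filter_add_sum_filter_not, sum_residueDeg_mul_idealOrd hp, hrank]
  have h2 : ∑ P ∈ A, residueDeg p P * idealOrd P θ + ∑ P ∈ B, residueDeg p P * idealOrd P θ =
      vb := by
    rw [hA, hB, Finset.sum_filter_add_sum_filter_not,
      sum_residueDeg_mul_idealOrd_root hp hθ0 hnorm hb hb']
  have h3 : 2 * ∑ P ∈ A, residueDeg p P * idealOrd P θ =
      va * ∑ P ∈ A, residueDeg p P * idealOrd P (p : R) := by
    rw [Finset.mul_sum, Finset.mul_sum]
    refine Finset.sum_congr rfl fun P hP => ?_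
    have := (Finset.mem_filter.1 hP).2
    linear_combination residueDeg p P * this
  have h4 : 5 * ∑ P ∈ B, residueDeg p P * idealOrd P θ =
      (vb - va) * ∑ P ∈ B, residueDeg p P * idealOrd P (p : R) := by
    rw [Finset.mul_sum, Finset.mul_sum]
    refine Finset.sum_congr rfl fun P hP => ?_
    have := (hor P (Finset.mem_filter.1 hP).1).resolve_left (Finset.mem_filter.1 hP).2
    linear_combination residueDeg p P * this
  have h5 : A.card ≤ ∑ P ∈ A, residueDeg p P * idealOrd P (p : R) := by
    rw [Finset.card_eq_sum_ones]
    refine Finset.sum_le_sum fun P hP => ?_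
    have hP' := (Finset.mem_filter.1 hP).1
    exact Nat.mul_pos (one_le_residueDeg hp hP') (one_le_idealOrd_of_mem_primesAbove hp hP')
  refine h5.trans (le_of_eq ?_)
  generalize ∑ P ∈ A, residueDeg p P * idealOrd P (p : R) = x at *
  generalize ∑ P ∈ B, residueDeg p P * idealOrd P (p : R) = y at *
  -- Degrees give x + y = 7 and the norm gives (va/2)x + ((vb - va)/5)y = vb; the slopes differ, so
  -- x = 2.
  have h6 : (5 * va : ℤ) * x + 2 * (vb - va) * y = 10 * vb := by
    have hle : va ≤ vb := by omega
    zify [hle] at h2 h3 h4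
    linear_combination 10 * h2 - 5 * h3 - 2 * h4
  have h7 : (7 * va - 2 * vb : ℤ) * ((x : ℤ) - 2) = 0 := by
    zify at h1
    linear_combination h6 - 2 * (vb - va) * h1
  rcases mul_eq_zero.1 h7 with h | h <;> omega

theorem card_filter_residueDeg_eq_one_le (hp : p.Prime) (hp35 : p = 3 ∨ p = 5) {a b : ℤ} {θ : R}
    (hrank : Module.finrank ℤ R = 7) (hθ0 : θ ≠ 0) (hθ : θ ^ 7 + a * θ ^ 5 + b = 0)
    (hnorm : ∀ m : ℤ, Algebra.norm ℤ ((m : R) - θ) = m ^ 7 + a * m ^ 5 + b)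
    (hne : ∀ m : ℤ, m ^ 7 + a * m ^ 5 + b ≠ 0) :
    ((primesAbove R p).filter fun P => residueDeg p P = 1).card ≤ p := by
  have hpz := Nat.prime_iff_prime_int.1 hp
  have hdecomp : ∀ m : ℤ, m ≠ 0 → ∃ (v : ℕ) (m' : ℤ), m = p ^ v * m' ∧ ¬ (p : ℤ) ∣ m' := by
    intro m hm
    obtain ⟨m', h, h'⟩ := (FiniteMultiplicity.of_prime_left hpz hm).exists_eq_pow_mul_and_not_dvd
    exact ⟨_, m', h, h'⟩
  obtain ⟨vb, b', hb, hb'⟩ := hdecomp b (by simpa using hne 0)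
  have hsub := Finset.filter_subset (fun P => residueDeg p P = 1) (primesAbove R p)
  by_cases hab : a = 0 ∨ ∃ (va : ℕ) (a' : ℤ), a = p ^ va * a' ∧ ¬ (p : ℤ) ∣ a' ∧ 2 * vb ≤ 7 * va
  · have hw : ∀ P ∈ primesAbove R p, 7 * idealOrd P θ = vb * idealOrd P (p : R) := by
      intro P hP
      rcases hab with h | ⟨va, a', h, h', hv⟩
      -- For a = 0 the value of `va` is irrelevant.
      · exact seven_mul_idealOrd_eq (va := 0) hp hθ0 hθ hb hb' (Or.inl h) (Or.inl h) hP
      · exact seven_mul_idealOrd_eq hp hθ0 hθ hb hb' (Or.inr ⟨a', h, h'⟩) (Or.inr hv) hP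
    by_cases h7 : 7 ∣ vb
    · obtain ⟨k, rfl⟩ := h7
      have hw' : ∀ P ∈ primesAbove R p, idealOrd P θ = k * idealOrd P (p : R) := fun P hP => by
        have := hw P hP
        rw [mul_assoc] at this
        omega
      obtain ⟨a'', ha''⟩ : ∃ a'' : ℤ, a * p ^ (5 * k) = p ^ (7 * k) * a'' := by
        rcases hab with rfl | ⟨va, a', rfl, -, hv⟩
        · exact ⟨0, by simp⟩
        · refine ⟨p ^ (va - 2 * k) * a', ?_⟩
          have : (p : ℤ) ^ va = p ^ (2 * k) * p ^ (va - 2 * k) := by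
            rw [← pow_add]; congr 1; omega
          rw [this, show 7 * k = 2 * k + 5 * k by ring, pow_add]
          ring
      obtain ⟨N, hN, hcard⟩ := exists_card_le_sum_residue (r := 0) hp hθ0 hnorm hne hb hb' ha'' rfl
        fun P hP => (hw' P hP).le
      have heq : (primesAbove R p).filter (fun P => residueDeg p P = 1) =
          (primesAbove R p).filter fun P =>
            residueDeg p P = 1 ∧ idealOrd P θ = k * idealOrd P (p : R) :=
        Finset.filter_congr fun P hP => ⟨fun h => ⟨h, hw' P hP⟩, fun h => h.1⟩
      rw [heq]
      refine hcard.trans ?_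
      rcases hp35 with rfl | rfl
      · exact card_le_three_of_pow_dvd hb' hN
      · exact (card_le_four_of_pow_dvd hb' hN).trans (by norm_num)
    -- Here 7 divides every e, so there is at most one prime.
    · have h1 := mul_card_le_of_dvd_idealOrd (d := 7) hp _ hsub fun P hP => by
        have h2 : 7 ∣ vb * idealOrd P (p : R) := ⟨_, (hw P (hsub hP)).symm⟩
        exact ((Nat.prime_seven.dvd_mul).1 h2).resolve_left h7
      have := hp.two_le
      omega
  · push Not at hab
    obtain ⟨ha0, hab⟩ := hab
    obtain ⟨va, a', ha, ha'⟩ := hdecomp a ha0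
    have hab := hab va a' ha ha'
    have hor := fun P hP => two_mul_idealOrd_eq_or (R := R) (P := P) hp hθ0 hθ hb hb' ha ha' hab hP
    have hA := card_filter_two_mul_idealOrd_le_two hp hrank hθ0 hnorm hb hb' hab hor
    set A := (primesAbove R p).filter fun P => 2 * idealOrd P θ = va * idealOrd P (p : R)
    set B := (primesAbove R p).filter fun P =>
      residueDeg p P = 1 ∧ 5 * idealOrd P θ = (vb - va) * idealOrd P (p : R) with hBdef
    have hunion : ((primesAbove R p).filter fun P => residueDeg p P = 1).card ≤
        A.card + B.card := by
      classical
      refine le_trans (Finset.card_le_card fun P hP => ?_) (Finset.card_union_le A B)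
      obtain ⟨hP, h1⟩ := Finset.mem_filter.1 hP
      rcases hor P hP with h | h
      · exact Finset.mem_union_left _ (Finset.mem_filter.2 ⟨hP, h⟩)
      · exact Finset.mem_union_right _ (Finset.mem_filter.2 ⟨hP, h1, h⟩)
    by_cases h5 : 5 ∣ vb - va
    · obtain ⟨k, hk⟩ := h5
      have hvb : vb = va + 5 * k := by omega
      have hkr : 7 * k = vb + (2 * k - va) := by omega
      have hBeq : B = (primesAbove R p).filter fun P =>
          residueDeg p P = 1 ∧ idealOrd P θ = k * idealOrd P (p : R) := by
        refine Finset.filter_congr fun P _ => and_congr_right fun _ => ?_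
        rw [hk, mul_assoc]
        omega
      have hle : ∀ P ∈ primesAbove R p, idealOrd P θ ≤ k * idealOrd P (p : R) := by
        intro P hP
        rcases hor P hP with h | h
        · have : va * idealOrd P (p : R) ≤ 2 * k * idealOrd P (p : R) :=
            Nat.mul_le_mul_right _ (by omega)
          rw [mul_assoc] at this
          omega
        · rw [hk, mul_assoc] at h
          omega
      obtain ⟨N, hN, hcard⟩ := exists_card_le_sum_residue (a' := a') (r := 2 * k - va)
        hp hθ0 hnorm hne hb hb' (by rw [ha, hvb, pow_add]; ring) hkr hle
      rw [← hBeq] at hcard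
      -- The strict inequality 7va < 2vb becomes va < 2k, so the leading coefficient p^r vanishes
      -- mod p. The totals are 2 + 1 = 3 and 2 + 3 = 5.
      have hr : 2 * k - va ≠ 0 := by omega
      rcases hp35 with rfl | rfl
      · have := card_le_one_of_pow_dvd_three hr hb' hN
        omega
      · have := card_le_three_of_pow_dvd_five hr hb' hN
        omega
    · have h1 := mul_card_le_of_dvd_idealOrd (d := 5) hp B (Finset.filter_subset _ _)
        fun P hP => by
          have h2 : 5 ∣ (vb - va) * idealOrd P (p : R) := ⟨_, (Finset.mem_filter.1 hP).2.2.symm⟩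
          exact ((Nat.prime_five.dvd_mul).1 h2).resolve_left h5
      omega

end DegreeOnePrimes

/-! ### Conclusion -/

section Main

theorem monic_X_pow_seven_add (a b : ℤ) : (X ^ 7 + C a * X ^ 5 + C b : ℤ[X]).Monic := by
  monicity!

theorem natDegree_X_pow_seven_add (a b : ℤ) :
    (X ^ 7 + C a * X ^ 5 + C b : ℤ[X]).natDegree = 7 := by
  compute_degree!

theorem not_dvd_fieldIndex_of_odd (a b : ℤ)
    (hF : Irreducible (X ^ 7 + C a * X ^ 5 + C b : ℤ[X]))
    (K : Type*) [Field K] [NumberField K] (θ : K)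
    (hθ : aeval θ (X ^ 7 + C a * X ^ 5 + C b : ℤ[X]) = 0)
    (hK : ℚ⟮θ⟯ = ⊤) {p : ℕ} (hp : p.Prime) (hodd : Odd p) : ¬ p ∣ fieldIndex K := by
  have hm := monic_X_pow_seven_add a b
  obtain ⟨θ, rfl⟩ : ∃ t : 𝓞 K, (t : K) = θ := ⟨⟨θ, _, hm, hθ⟩, rfl⟩
  have hrank : Module.finrank ℤ (𝓞 K) = 7 := by
    rw [NumberField.RingOfIntegers.rank, finrank_eq_natDegree_of_irreducible hF hm hθ hK,
      natDegree_X_pow_seven_add]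
  have hne : ∀ m : ℤ, m ^ 7 + a * m ^ 5 + b ≠ 0 := fun m h => by
    have h1 := (prime_X_sub_C m).irreducible.associated_of_dvd hF
      (dvd_iff_isRoot.2 (by simpa using h))
    have h2 := natDegree_eq_of_degree_eq (degree_eq_degree_of_associated h1)
    rw [natDegree_X_sub_C, natDegree_X_pow_seven_add] at h2
    norm_num at h2
  have hnorm : ∀ m : ℤ, Algebra.norm ℤ ((m : 𝓞 K) - θ) = m ^ 7 + a * m ^ 5 + b := fun m => by
    rw [norm_intCast_sub_eq_eval hF hm hθ hK]
    simp
  have hθ' : θ ^ 7 + a * θ ^ 5 + b = 0 := by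
    apply NumberField.RingOfIntegers.coe_injective
    simpa using hθ
  have hθ0 : θ ≠ 0 := by
    rintro rfl
    have h0 := hne 0
    simp at hθ' h0
    exact h0 hθ'
  have hp2 : p ≠ 2 := by
    rintro rfl
    exact absurd hodd (by decide)
  have : Fact p.Prime := ⟨hp⟩
  have hsum : ∑ P ∈ primesAbove (𝓞 K) p, residueDeg p P ≤ 7 := by
    rw [← hrank, ← sum_residueDeg_mul_idealOrd hp]
    exact Finset.sum_le_sum fun P hP =>
      Nat.le_mul_of_pos_right _ (one_le_idealOrd_of_mem_primesAbove hp hP)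
  have hone : ((primesAbove (𝓞 K) p).filter fun P => residueDeg p P = 1).card ≤ p := by
    by_cases hp35 : p = 3 ∨ p = 5
    · exact card_filter_residueDeg_eq_one_le hp hp35 hrank hθ0 hθ' hnorm hne
    · have h7 : 7 ≤ p := by
        by_contra! h
        have := hp.two_le
        interval_cases p <;> first | omega | (exact absurd hp (by norm_num))
      refine le_trans ?_ h7
      have h1 := mul_card_le_of_dvd_idealOrd (d := 1) hp _ (Finset.filter_subset
        (fun P => residueDeg p P = 1) (primesAbove (𝓞 K) p)) fun _ _ => one_dvd _
      omega
  obtain ⟨g, hinj, hg⟩ := ZMod.exists_injOn_irreducible hp2 (primesAbove (𝓞 K) p) (residueDeg p)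
    (fun P hP => one_le_residueDeg hp hP) hsum hone
  obtain ⟨η, h1, h2⟩ := exists_not_dvd_elementIndex (fun P hP => (hg P hP).2.1)
    (fun P hP => (hg P hP).1) (fun P hP => (hg P hP).2.2) hinj
  exact not_dvd_fieldIndex_of_not_dvd_elementIndex h1 h2

theorem mainTheorem1 (a b : ℤ)
    (hF : Irreducible (X ^ 7 + C a * X ^ 5 + C b : ℤ[X]))
    (K : Type*) [Field K] [NumberField K] (θ : K)
    (hθ : aeval θ (X ^ 7 + C a * X ^ 5 + C b : ℤ[X]) = 0)
    (hK : ℚ⟮θ⟯ = ⊤) :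
    (∀ p : ℕ, p.Prime → Odd p → ¬ IsCommonIndexDivisor K p ∧ ¬ p ∣ fieldIndex K) ∧
      ∃ k : ℕ, fieldIndex K = 2 ^ k := by
  have h := fun {p : ℕ} => not_dvd_fieldIndex_of_odd a b hF K θ hθ hK (p := p)
  refine ⟨fun p hp hodd => ⟨fun hc => h hp hodd hc.2, h hp hodd⟩, ?_⟩
  -- Zero would be divisible by the odd prime 3.
  have h0 : fieldIndex K ≠ 0 := fun h0 => h Nat.prime_three (by decide) (h0 ▸ dvd_zero 3)
  refine ⟨_, Nat.eq_prime_pow_of_unique_prime_dvd h0 fun {q} hq hd => ?_⟩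
  by_contra h2
  exact h hq (hq.odd_of_ne_two h2) hd

end Main
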